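/- Let $N\ge 2$ and let $\Omega\subset\mathbb R^N$ be a bounded domain (a nonempty, open, connected, bounded set; no regularity of $\partial\Omega$ is needed). Let $J,G:\mathbb R^N\to\mathbb R$ be continuous, nonnegative, radial, compactly supported, with $J(0),G(0)>0$ and $\int_{\mathbb R^N}J=\int_{\mathbb R^N}G=1$, and assume $B_R(0)\subset\operatorname{supp}J$ for some $R>\operatorname{diam}\Omega$. Let $Y=(0,\ell_1)\times\dots\times(0,\ell_N)$ with all $\ell_i>0$, let $T$ be an open set with $\overline T\subset Y$ (no regularity of $\partial T$ is needed), put $X=|T|/|Y|$ and assume $0<X<1$. For $n\ge1$ let $T_n(k)=\frac1n(k\ell+T)$, $k\in\mathbb Z^N$, where $k\ell=(k_1\ell_1,\dots,k_N\ell_N)$, and let $$A_n=\bigcup\Big\{T_n(k)\;:\;k\in\mathbb Z^N,\ \tfrac1n(k\ell+\overline T)\subset\Omega\Big\},\qquad B_n=\Omega\setminus A_n .$$ Let $f_n,f\in L^2(\Omega)$ with $\int_\Omega f_n=0$ for all $n\ge1$ and $f_n\to f$ strongly in $L^2(\Omega)$. Let $W_n=\{(\varphi,\phi)\in H^1(A_n)\times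 L^2(B_n):\int_{A_n}\varphi+\int_{B_n}\phi=0\}$ and, for $n\ge1$, let $(u_n,v_n)\in W_n$ be the weak solution of the coupled local/nonlocal Neumann problem with the local part in the holes, i.e. for all $(\varphi,\phi)\in W_n$ $$\int_{A_n}\nabla u_n\cdot\nabla\varphi\,dx+\frac12\int_{B_n}\!\int_{B_n}G(x-y)(v_n(y)-v_n(x))(\phi(y)-\phi(x))\,dy\,dx+\int_{A_n}\!\int_{B_n}J(x-y)(v_n(y)-u_n(x))(\phi(y)-\varphi(x))\,dy\,dx=-\int_{A_n}f_n\varphi\,dx-\int_{B_n}f_n\phi\,dx .$$ Let $(u,v)\in L^2(\Omega)\times L^2(\Omega)$, with $u$ continuous on $\overline\Omega$ and $\int_\Omega u+\int_\Omega v=0$, be the solution of the homogenized system: for a.e. $x\in\Omega$, $$f(x)X=\int_\Omega J(x-y)\big(Xv(y)-(1-X)u(x)\big)\,dy,$$ $$f(x)(1-X)=\int_\Omega G(x-y)\big((1-X)v(y)-(1-X)v(x)\big)\,dy+\int_\Omega J(x-y)\big((1-X)u(y)-Xv(x)\big)\,dy .$$ Define the correctors by $w_{1,n}=u/X$ on $B_n$,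 $w_{1,n}=\frac1{|T_n(k)|}\int_{T_n(k)}\frac{u(z)}{X}\,dz$ on each hole $T_n(k)\subset A_n$ that occurs in the union above, $w_{2,n}=\dfrac{\chi_{B_n}v}{1-X}$, and $m_n=\int_{A_n}w_{1,n}\,dx+\int_{B_n}w_{2,n}\,dx$. Then $\chi_{A_n}\rightharpoonup X$ and $\chi_{B_n}\rightharpoonup 1-X$ weakly-* in $L^\infty(\Omega)$, and $$\Big\|u_n-\Big(w_{1,n}-\frac12\frac{m_n}{|A_n|}\Big)\Big\|_{L^2(A_n)}+\Big\|v_n-\Big(w_{2,n}-\frac12\frac{m_n}{|B_n|}\Big)\Big\|_{L^2(B_n)}\longrightarrow0\qquad\text{as }n\to\infty .$$ -/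

import Mathlib

open MeasureTheory Filter Topology
open scoped ContDiff

namespace LocalHoles

/-- The ambient space `ℝ^N` with its Euclidean norm and Lebesgue measure. -/
abbrev Space (N : ℕ) : Type := EuclideanSpace ℝ (Fin N)

/-! ### Kernels -/

/-- Continuous, nonnegative, radial, compactly supported probability densities that are positive
at the origin. -/
structure IsKernel {N : ℕ} (K : Space N → ℝ) : Prop where
  continuous : Continuous K
  nonneg : ∀ z, 0 ≤ K z
  radial : ∀ z z', ‖z‖ = ‖z'‖ → K z = K z'
  hasCompactSupport : HasCompactSupport K
  pos_zero : 0 < K 0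
  integral_eq_one : ∫ z, K z = 1

/-! ### Periodic holes -/

/-- The periodicity cell `Y = (0, ℓ₁) × ⋯ × (0, ℓ_N)`. -/
def cell {N : ℕ} (ℓ : Fin N → ℝ) : Set (Space N) :=
  {x | ∀ i, 0 < x i ∧ x i < ℓ i}

/-- The lattice vector `kℓ = (k₁ ℓ₁, …, k_N ℓ_N)`. -/
noncomputable def latticeVec {N : ℕ} (ℓ : Fin N → ℝ) (k : Fin N → ℤ) : Space N :=
  WithLp.toLp 2 (fun i => (k i : ℝ) * ℓ i)

/-- The rescaled translate `(1/n) (kℓ + S)` of a set `S`. -/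
def scaledCopy {N : ℕ} (ℓ : Fin N → ℝ) (n : ℕ) (k : Fin N → ℤ) (S : Set (Space N)) :
    Set (Space N) :=
  (fun x => (1 / (n : ℝ)) • (latticeVec ℓ k + x)) '' S

/-- The indices of the holes that are kept: those whose closure `(1/n) (kℓ + T̄)` lies in `Ω`. -/
def holeIndex {N : ℕ} (Ω : Set (Space N)) (ℓ : Fin N → ℝ) (T : Set (Space N)) (n : ℕ) :
    Set (Fin N → ℤ) :=
  {k | scaledCopy ℓ n k (closure T) ⊆ Ω}

/-- The local region `A_n`, the union of the holes `T_n(k) = (1/n) (kℓ + T)` that are kept. -/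
def localRegion {N : ℕ} (Ω : Set (Space N)) (ℓ : Fin N → ℝ) (T : Set (Space N)) (n : ℕ) :
    Set (Space N) :=
  ⋃ k ∈ holeIndex Ω ℓ T n, scaledCopy ℓ n k T

/-- The nonlocal region `B_n = Ω \ A_n`. -/
def nonlocalRegion {N : ℕ} (Ω : Set (Space N)) (ℓ : Fin N → ℝ) (T : Set (Space N)) (n : ℕ) :
    Set (Space N) :=
  Ω \ localRegion Ω ℓ T n

/-- The volume fraction `X = |T| / |Y|` of the holes. -/
noncomputable def holeFraction {N : ℕ} (ℓ : Fin N → ℝ) (T : Set (Space N)) : ℝ :=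
  volume.real T / volume.real (cell ℓ)

/-- Weak-* convergence in `L^∞(Ω)`: convergence against every function in `L¹(Ω)`. -/
def TendstoWeakStar {N : ℕ} (Ω : Set (Space N)) (h : ℕ → Space N → ℝ) (h' : Space N → ℝ) : Prop :=
  ∀ g : Space N → ℝ, IntegrableOn g Ω →
    Tendsto (fun n => ∫ x in Ω, h n x * g x) atTop (𝓝 (∫ x in Ω, h' x * g x))

/-! ### The Sobolev space `H¹` and the coupled problem -/

/-- `u ∈ H¹(U)` with weak gradient `gu`: both are square integrable on the open set `U`, and
`∫_U u ∂ᵢη = - ∫_U (gu)ᵢ η` for every test function `η ∈ C_c^∞(U)` and every `i`. -/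
structure IsH1 {N : ℕ} (U : Set (Space N)) (u : Space N → ℝ) (gu : Space N → Space N) : Prop where
  memLp : MemLp u 2 (volume.restrict U)
  memLp_grad : MemLp gu 2 (volume.restrict U)
  weak_grad : ∀ η : Space N → ℝ, ContDiff ℝ ∞ η → HasCompactSupport η → tsupport η ⊆ U →
    ∀ i : Fin N, ∫ x in U, u x * fderiv ℝ η x (EuclideanSpace.single i 1)
      = - (∫ x in U, gu x i * η x)

/-- `(u, v) ∈ W = {(u, v) ∈ H¹(A) × L²(B) : ∫_A u + ∫_B v = 0}`, where `gu` is the weak gradient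
of `u` on `A`. -/
structure IsAdmissible {N : ℕ} (A B : Set (Space N)) (u : Space N → ℝ) (gu : Space N → Space N)
    (v : Space N → ℝ) : Prop where
  isH1 : IsH1 A u gu
  memLp : MemLp v 2 (volume.restrict B)
  mean_zero : (∫ x in A, u x) + (∫ x in B, v x) = 0

/-- The bilinear form of the coupled local/nonlocal problem on `A` (local) and `B` (nonlocal);
`gu` and `gφ` are the weak gradients of `u` and `φ`. -/
noncomputable def couplingForm {N : ℕ} (J G : Space N → ℝ) (A B : Set (Space N))
    (u : Space N → ℝ) (gu : Space N → Space N) (v : Space N → ℝ)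
    (φ : Space N → ℝ) (gφ : Space N → Space N) (ψ : Space N → ℝ) : ℝ :=
  (∫ x in A, inner ℝ (gu x) (gφ x))
    + (1 / 2) * (∫ x in B, ∫ y in B, G (x - y) * (v y - v x) * (ψ y - ψ x))
    + (∫ x in A, ∫ y in B, J (x - y) * (v y - u x) * (ψ y - φ x))

/-- `(u, v)` is the weak solution in `W` of the coupled Neumann problem with source `f`. -/
def IsWeakSolution {N : ℕ} (J G : Space N → ℝ) (A B : Set (Space N)) (f : Space N → ℝ)
    (u v : Space N → ℝ) : Prop :=
  ∃ gu : Space N → Space N, IsAdmissible A B u gu v ∧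
    ∀ (φ : Space N → ℝ) (gφ : Space N → Space N) (ψ : Space N → ℝ), IsAdmissible A B φ gφ ψ →
      couplingForm J G A B u gu v φ gφ ψ = - (∫ x in A, f x * φ x) - (∫ x in B, f x * ψ x)

/-! ### The homogenized system and the correctors -/

/-- `(u, v) ∈ L²(Ω) × L²(Ω)` solves the homogenized system with source `f`, volume fraction `X`,
and total mean zero. -/
structure IsHomogenizedSolution {N : ℕ} (J G : Space N → ℝ) (Ω : Set (Space N)) (X : ℝ)
    (f u v : Space N → ℝ) : Prop where
  memLp_left : MemLp u 2 (volume.restrict Ω)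
  memLp_right : MemLp v 2 (volume.restrict Ω)
  mean_zero : (∫ x in Ω, u x) + (∫ x in Ω, v x) = 0
  eq_left : ∀ᵐ x ∂(volume.restrict Ω),
    f x * X = ∫ y in Ω, J (x - y) * (X * v y - (1 - X) * u x)
  eq_right : ∀ᵐ x ∂(volume.restrict Ω),
    f x * (1 - X) = (∫ y in Ω, G (x - y) * ((1 - X) * v y - (1 - X) * v x))
      + (∫ y in Ω, J (x - y) * ((1 - X) * u y - X * v x))

open Classical in
/-- `w_{1,n}`: the average of `u / X` over each hole of `A_n`, and `u / X` elsewhere. -/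
noncomputable def corrector₁ {N : ℕ} (Ω : Set (Space N)) (ℓ : Fin N → ℝ) (T : Set (Space N))
    (X : ℝ) (u : Space N → ℝ) (n : ℕ) (x : Space N) : ℝ :=
  if x ∈ localRegion Ω ℓ T n then
    ∑ᶠ k ∈ holeIndex Ω ℓ T n,
      (scaledCopy ℓ n k T).indicator (fun _ => ⨍ z in scaledCopy ℓ n k T, u z / X) x
  else u x / X

/-- `w_{2,n} = χ_{B_n} v / (1 - X)`. -/
noncomputable def corrector₂ {N : ℕ} (Ω : Set (Space N)) (ℓ : Fin N → ℝ) (T : Set (Space N))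
    (X : ℝ) (v : Space N → ℝ) (n : ℕ) (x : Space N) : ℝ :=
  (nonlocalRegion Ω ℓ T n).indicator v x / (1 - X)

/-- `m_n = ∫_{A_n} w_{1,n} + ∫_{B_n} w_{2,n}`. -/
noncomputable def correctorMass {N : ℕ} (Ω : Set (Space N)) (ℓ : Fin N → ℝ) (T : Set (Space N))
    (X : ℝ) (u v : Space N → ℝ) (n : ℕ) : ℝ :=
  (∫ x in localRegion Ω ℓ T n, corrector₁ Ω ℓ T X u n x)
    + (∫ x in nonlocalRegion Ω ℓ T n, corrector₂ Ω ℓ T X v n x)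

end LocalHoles

/-! The proof is an energy estimate for the error. Up to a common additive constant, the comparison
pair is `corrector₁` on `A_n` and `v / (1 - X)` on `B_n`. The first function is constant on every
hole, hence locally constant on the open set `A_n`, so its weak gradient vanishes and the error in
`A_n` has the same gradient as `u_n`. Subtracting `m_n / |Ω|` from both components gives the error
pair total mean zero, so it is an admissible test pair.

Testing the equation with the error itself and discarding the nonnegative gradient and `G` terms
leaves (`couplingEnergy_le_residual`) a bound of the `J`-coupling energy of the error by its pairing
with two residuals. These measure by how much the comparison pair fails to solve the nonlocal
equations on `A_n` and `B_n`. Two facts then conclude.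

Coercivity (`exists_crossVariation_le`, `IsKernel.exists_integral_sq_le`): for functions of mean
zero on `Ω`, the `L²` norm is controlled by the `J`-coupling energy alone, with a constant
independent of `n`. Nearby portions of `A_n` and `B_n` are coupled directly because `J` is positive
near the origin, and connectedness of `Ω` allows chains of small balls. The chains do not
degenerate, since both phases occupy a fixed amount of every ball. No extension operator on the
holes, and hence no regularity of `T` or `Ω`, is involved.

Consistency (`tendstoZeroL2_residual₁`, `tendstoZeroL2_residual₂`): both residuals tend to zero in
`L²`. Weak-* convergence of the characteristic functions becomes pointwise, dominated convergence
after integration against a kernel; the hole averages are uniformly close to `u / X` because `u` is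
uniformly continuous; and the limit expression vanishes by the homogenized system.

Young's inequality combines the two. The normalization in the theorem, `m_n / (2|A_n|)` and `m_n /
(2|B_n|)` instead of `m_n / |Ω|`, makes no difference in the limit because `m_n → 0`. -/

namespace LocalHoles

/-! ### Geometry of the scaled copies -/

section Geometry

variable {N : ℕ} {ℓ : Fin N → ℝ} {T Ω : Set (Space N)} {n : ℕ}

/-- The half-open periodicity cell. -/
def halfOpenCell (ℓ : Fin N → ℝ) : Set (Space N) :=
  {x | ∀ i, 0 ≤ x i ∧ x i < ℓ i}

lemma cell_subset_halfOpenCell : cell ℓ ⊆ halfOpenCell ℓ :=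
  fun _ hx i => ⟨(hx i).1.le, (hx i).2⟩

lemma zero_mem_halfOpenCell (hℓ : ∀ i, 0 < ℓ i) : (0 : Space N) ∈ halfOpenCell ℓ :=
  fun i => ⟨le_rfl, hℓ i⟩

lemma mem_scaledCopy_iff (hn : 1 ≤ n) {k : Fin N → ℤ} {S : Set (Space N)} {x : Space N} :
    x ∈ scaledCopy ℓ n k S ↔ (n : ℝ) • x - latticeVec ℓ k ∈ S := by
  have hn0 : (n : ℝ) ≠ 0 := by positivity
  constructor
  · rintro ⟨y, hy, rfl⟩
    simpa [smul_smul, hn0] using hy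
  · intro h
    refine ⟨_, h, ?_⟩
    simp [smul_smul, hn0]

lemma scaledCopy_mono {k : Fin N → ℤ} {S S' : Set (Space N)} (h : S ⊆ S') :
    scaledCopy ℓ n k S ⊆ scaledCopy ℓ n k S' :=
  Set.image_mono h

lemma scaledCopy_eq_preimage (hn : 1 ≤ n) (k : Fin N → ℤ) (S : Set (Space N)) :
    scaledCopy ℓ n k S = (fun x : Space N => (n : ℝ) • x - latticeVec ℓ k) ⁻¹' S :=
  Set.ext fun _ => mem_scaledCopy_iff hn

lemma isOpen_scaledCopy (hn : 1 ≤ n) (k : Fin N → ℤ) {S : Set (Space N)} (hS : IsOpen S) :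
    IsOpen (scaledCopy ℓ n k S) := by
  rw [scaledCopy_eq_preimage hn]
  exact hS.preimage (by fun_prop)

lemma measurableSet_scaledCopy (hn : 1 ≤ n) (k : Fin N → ℤ) {S : Set (Space N)}
    (hS : MeasurableSet S) : MeasurableSet (scaledCopy ℓ n k S) := by
  rw [scaledCopy_eq_preimage hn]
  exact measurableSet_preimage (by fun_prop) hS

open scoped Pointwise in
lemma volume_scaledCopy (k : Fin N → ℤ) (S : Set (Space N)) :
    volume (scaledCopy ℓ n k S) = ENNReal.ofReal |(1 / (n : ℝ)) ^ N| * volume S := by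
  have : scaledCopy ℓ n k S = (1 / (n : ℝ)) • ((fun x => latticeVec ℓ k + x) '' S) := by
    simp only [scaledCopy, ← Set.image_smul, Set.image_image]
  rw [this, Measure.addHaar_smul, finrank_euclideanSpace_fin, Set.image_add_left,
    measure_preimage_add]

/-- The index of the scaled half-open cell that contains `x`. -/
noncomputable def cellIndex (ℓ : Fin N → ℝ) (n : ℕ) (x : Space N) : Fin N → ℤ :=
  fun i => ⌊(n : ℝ) * x i / ℓ i⌋

/-- Half-open cells tile the whole space exactly, so taking floors coordinate by coordinate
identifies the unique cell of a point. Disjointness of cells and of holes is always deduced from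
this. -/
lemma mem_scaledCopy_halfOpenCell (hℓ : ∀ i, 0 < ℓ i) (hn : 1 ≤ n) {k : Fin N → ℤ}
    {x : Space N} : x ∈ scaledCopy ℓ n k (halfOpenCell ℓ) ↔ cellIndex ℓ n x = k := by
  rw [mem_scaledCopy_iff hn, funext_iff]
  refine forall_congr' fun i => ?_
  have hi := hℓ i
  simp only [cellIndex, latticeVec, PiLp.sub_apply, PiLp.smul_apply, smul_eq_mul, Int.floor_eq_iff,
    le_div_iff₀ hi, div_lt_iff₀ hi]
  constructor <;> rintro ⟨h1, h2⟩ <;> constructor <;> nlinarith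

lemma cellIndex_of_mem (hℓ : ∀ i, 0 < ℓ i) (hn : 1 ≤ n) {k : Fin N → ℤ} {S : Set (Space N)}
    (hS : S ⊆ cell ℓ) {x : Space N} (hx : x ∈ scaledCopy ℓ n k S) : cellIndex ℓ n x = k :=
  (mem_scaledCopy_halfOpenCell hℓ hn).1 (scaledCopy_mono (hS.trans cell_subset_halfOpenCell) hx)

lemma isBounded_halfOpenCell (ℓ : Fin N → ℝ) : Bornology.IsBounded (halfOpenCell ℓ) := by
  have h : halfOpenCell ℓ ⊆ WithLp.ofLp ⁻¹' (Set.Icc 0 ℓ) :=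
    fun x hx => ⟨fun i => (hx i).1, fun i => (hx i).2.le⟩
  exact ((PiLp.antilipschitzWith_ofLp 2 (fun _ : Fin N => ℝ)).isBounded_preimage
    (Metric.isBounded_Icc 0 ℓ)).subset h

lemma volume_cell (ℓ : Fin N → ℝ) : volume (cell ℓ) = ∏ i, ENNReal.ofReal (ℓ i) := by
  have h : cell ℓ = (MeasurableEquiv.toLp 2 (Fin N → ℝ)).symm ⁻¹'
      (Set.univ.pi fun i => Set.Ioo 0 (ℓ i)) := by
    ext x; simp [cell]
  rw [h, (EuclideanSpace.volume_preserving_symm_measurableEquiv_toLp (Fin N)).measure_preimage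
    (MeasurableSet.univ_pi fun _ => measurableSet_Ioo).nullMeasurableSet, Real.volume_pi_Ioo]
  simp

lemma measurableSet_halfOpenCell (ℓ : Fin N → ℝ) : MeasurableSet (halfOpenCell ℓ) := by
  have h : halfOpenCell ℓ = (MeasurableEquiv.toLp 2 (Fin N → ℝ)).symm ⁻¹'
      (Set.univ.pi fun i => Set.Ico 0 (ℓ i)) := by
    ext x; simp [halfOpenCell]
  rw [h]
  exact measurableSet_preimage (MeasurableEquiv.measurable _)
    (MeasurableSet.univ_pi fun _ => measurableSet_Ico)

lemma volume_halfOpenCell (ℓ : Fin N → ℝ) : volume (halfOpenCell ℓ) = volume (cell ℓ) := by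
  have h : halfOpenCell ℓ = (MeasurableEquiv.toLp 2 (Fin N → ℝ)).symm ⁻¹'
      (Set.univ.pi fun i => Set.Ico 0 (ℓ i)) := by
    ext x; simp [halfOpenCell]
  rw [h, (EuclideanSpace.volume_preserving_symm_measurableEquiv_toLp (Fin N)).measure_preimage
    (MeasurableSet.univ_pi fun _ => measurableSet_Ico).nullMeasurableSet, Real.volume_pi_Ico,
    volume_cell]
  simp

lemma volume_cell_real_pos (hℓ : ∀ i, 0 < ℓ i) : 0 < volume.real (cell ℓ) := by
  rw [Measure.real, volume_cell, ENNReal.toReal_prod]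
  exact Finset.prod_pos fun i _ => by simpa [ENNReal.toReal_ofReal (hℓ i).le] using hℓ i

/-- Two points in one scaled cell are within `diam Y / n`. -/
lemma dist_le_of_mem_scaledCopy {k : Fin N → ℤ} {x y : Space N}
    (hx : x ∈ scaledCopy ℓ n k (halfOpenCell ℓ)) (hy : y ∈ scaledCopy ℓ n k (halfOpenCell ℓ)) :
    dist x y ≤ Metric.diam (halfOpenCell ℓ) / n := by
  obtain ⟨a, ha, rfl⟩ := hx
  obtain ⟨b, hb, rfl⟩ := hy
  rw [dist_smul₀, dist_add_left, Real.norm_of_nonneg (show (0 : ℝ) ≤ 1 / n by positivity),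
    one_div_mul_eq_div]
  exact div_le_div_of_nonneg_right
    (Metric.dist_le_diam_of_mem (isBounded_halfOpenCell ℓ) ha hb) n.cast_nonneg

/-- The corner of the scaled cell that contains `x`. -/
noncomputable def cellCorner (ℓ : Fin N → ℝ) (n : ℕ) (x : Space N) : Space N :=
  (1 / (n : ℝ)) • latticeVec ℓ (cellIndex ℓ n x)

lemma measurable_cellCorner (ℓ : Fin N → ℝ) (n : ℕ) : Measurable (cellCorner ℓ n) := by
  suffices h : Measurable fun x : Space N => latticeVec ℓ (cellIndex ℓ n x) from
    h.const_smul (1 / (n : ℝ))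
  unfold latticeVec cellIndex
  refine (MeasurableEquiv.toLp 2 (Fin N → ℝ)).measurable.comp (measurable_pi_iff.2 fun i => ?_)
  have : Measurable fun x : Space N => (n : ℝ) * x i / ℓ i := by fun_prop
  exact (measurable_from_top.comp (Int.measurable_floor.comp this)).mul_const _

lemma dist_cellCorner_le (hℓ : ∀ i, 0 < ℓ i) (hn : 1 ≤ n) (x : Space N) :
    dist (cellCorner ℓ n x) x ≤ Metric.diam (halfOpenCell ℓ) / n := by
  refine dist_le_of_mem_scaledCopy (k := cellIndex ℓ n x) ?_
    ((mem_scaledCopy_halfOpenCell hℓ hn).2 rfl)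
  exact ⟨0, zero_mem_halfOpenCell hℓ, by simp [cellCorner]⟩

lemma tendsto_diam_div (ℓ : Fin N → ℝ) :
    Tendsto (fun n : ℕ => Metric.diam (halfOpenCell ℓ) / n) atTop (𝓝 0) :=
  tendsto_const_div_atTop_nhds_zero_nat _

/-- The union of all scaled holes. -/
def periodicHoles (ℓ : Fin N → ℝ) (T : Set (Space N)) (n : ℕ) : Set (Space N) :=
  ⋃ k, scaledCopy ℓ n k T

lemma isOpen_localRegion (hn : 1 ≤ n) (hT : IsOpen T) : IsOpen (localRegion Ω ℓ T n) :=
  isOpen_biUnion fun k _ => isOpen_scaledCopy hn k hT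

lemma localRegion_subset : localRegion Ω ℓ T n ⊆ Ω :=
  Set.iUnion₂_subset fun _ hk => (scaledCopy_mono subset_closure).trans hk

lemma localRegion_subset_periodicHoles : localRegion Ω ℓ T n ⊆ periodicHoles ℓ T n :=
  Set.iUnion₂_subset fun k _ => Set.subset_iUnion (fun k => scaledCopy ℓ n k T) k

lemma measurableSet_periodicHoles (hn : 1 ≤ n) (hT : IsOpen T) :
    MeasurableSet (periodicHoles ℓ T n) :=
  (isOpen_iUnion fun k => isOpen_scaledCopy hn k hT).measurableSet

lemma mem_localRegion_iff {x : Space N} :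
    x ∈ localRegion Ω ℓ T n ↔ ∃ k ∈ holeIndex Ω ℓ T n, x ∈ scaledCopy ℓ n k T := by
  simp [localRegion]

/-- A point of the open set `Ω` lies in a hole only if this hole is kept, as soon as `n` is
large. -/
lemma eventually_notMem_periodicHoles_diff (hΩ : IsOpen Ω)
    (hT : closure T ⊆ cell ℓ) {x : Space N} (hx : x ∈ Ω) :
    ∀ᶠ n in atTop, x ∉ periodicHoles ℓ T n \ localRegion Ω ℓ T n := by
  obtain ⟨ε, hε, hball⟩ := Metric.isOpen_iff.1 hΩ x hx
  filter_upwards [(tendsto_diam_div ℓ).eventually (gt_mem_nhds hε), eventually_ge_atTop 1]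
    with n hnε hn
  rintro ⟨hP, hA⟩
  obtain ⟨k, hk⟩ := Set.mem_iUnion.1 hP
  -- The closed hole around `x` has diameter below `ε`, so it stays in the ball inside `Ω` and the
  -- hole is kept.
  refine hA (mem_localRegion_iff.2 ⟨k, fun y hy => hball ?_, hk⟩)
  have h := dist_le_of_mem_scaledCopy
    (scaledCopy_mono (hT.trans cell_subset_halfOpenCell) hy)
    (scaledCopy_mono (subset_closure.trans (hT.trans cell_subset_halfOpenCell)) hk)
  exact lt_of_le_of_lt h hnε

lemma periodicHoles_inter_scaledCopy (hℓ : ∀ i, 0 < ℓ i) (hn : 1 ≤ n) (hT : T ⊆ cell ℓ)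
    (k : Fin N → ℤ) :
    periodicHoles ℓ T n ∩ scaledCopy ℓ n k (halfOpenCell ℓ) = scaledCopy ℓ n k T := by
  ext x
  constructor
  · rintro ⟨hx, hxk⟩
    obtain ⟨j, hj⟩ := Set.mem_iUnion.1 hx
    rw [mem_scaledCopy_halfOpenCell hℓ hn, cellIndex_of_mem hℓ hn hT hj] at hxk
    exact hxk ▸ hj
  · exact fun hx => ⟨Set.mem_iUnion.2 ⟨k, hx⟩,
      scaledCopy_mono (hT.trans cell_subset_halfOpenCell) hx⟩

/-! ### Weak-* convergence of the characteristic functions -/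

lemma volume_cell_ne_top (ℓ : Fin N → ℝ) : volume (cell ℓ) ≠ ⊤ := by
  rw [volume_cell]
  exact ENNReal.prod_ne_top fun i _ => ENNReal.ofReal_ne_top

lemma volume_scaledCopy_ne_top {S : Set (Space N)} (hS : volume S ≠ ⊤) (k : Fin N → ℤ) :
    volume (scaledCopy ℓ n k S) ≠ ⊤ := by
  rw [volume_scaledCopy]
  exact ENNReal.mul_ne_top ENNReal.ofReal_ne_top hS

/-- The oscillation `χ_{P_n} - X` of the characteristic function of the periodic holes. -/
noncomputable def holeOscillation (ℓ : Fin N → ℝ) (T : Set (Space N)) (n : ℕ) (x : Space N) : ℝ :=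
  (periodicHoles ℓ T n).indicator (fun _ => 1) x - holeFraction ℓ T

lemma holeFraction_mem_Icc (hT : T ⊆ cell ℓ) : holeFraction ℓ T ∈ Set.Icc (0 : ℝ) 1 := by
  refine ⟨by unfold holeFraction; positivity, div_le_one_of_le₀ ?_ measureReal_nonneg⟩
  exact measureReal_mono hT (volume_cell_ne_top ℓ)

lemma abs_holeOscillation_le (hT : T ⊆ cell ℓ) (x : Space N) : |holeOscillation ℓ T n x| ≤ 1 := by
  obtain ⟨h0, h1⟩ := holeFraction_mem_Icc hT
  unfold holeOscillation
  by_cases hx : x ∈ periodicHoles ℓ T n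
  · rw [Set.indicator_of_mem hx, abs_le]; constructor <;> linarith
  · rw [Set.indicator_of_notMem hx, abs_le]; constructor <;> linarith

lemma measurable_holeOscillation (hn : 1 ≤ n) (hT : IsOpen T) :
    Measurable (holeOscillation ℓ T n) :=
  (measurable_const.indicator (measurableSet_periodicHoles hn hT)).sub_const _

/-- Scaling multiplies the volumes of the hole and of the cell by the same factor, so the hole fills
the fraction `|T| / |Y|` of each scaled cell. -/
lemma setIntegral_holeOscillation (hℓ : ∀ i, 0 < ℓ i) (hn : 1 ≤ n) (hTo : IsOpen T)
    (hT : T ⊆ cell ℓ) (k : Fin N → ℤ) :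
    ∫ x in scaledCopy ℓ n k (halfOpenCell ℓ), holeOscillation ℓ T n x = 0 := by
  have htop : volume (scaledCopy ℓ n k (halfOpenCell ℓ)) ≠ ⊤ :=
    volume_scaledCopy_ne_top (by rw [volume_halfOpenCell]; exact volume_cell_ne_top ℓ) k
  have hfin : IsFiniteMeasure (volume.restrict (scaledCopy ℓ n k (halfOpenCell ℓ))) :=
    isFiniteMeasure_restrict.2 htop
  have hP := measurableSet_periodicHoles (ℓ := ℓ) hn hTo
  unfold holeOscillation
  rw [integral_sub ((integrable_const (1 : ℝ)).indicator hP) (integrable_const _),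
    integral_indicator_const _ hP, integral_const, measureReal_restrict_apply hP,
    periodicHoles_inter_scaledCopy hℓ hn hT, measureReal_restrict_apply MeasurableSet.univ,
    Set.univ_inter]
  simp only [Measure.real, volume_scaledCopy, volume_halfOpenCell, ENNReal.toReal_mul, smul_eq_mul,
    mul_one, holeFraction]
  have := (volume_cell_real_pos hℓ).ne'
  rw [Measure.real] at this
  field_simp
  ring

lemma integrable_holeOscillation_mul (hn : 1 ≤ n) (hTo : IsOpen T) (hT : T ⊆ cell ℓ)
    {g : Space N → ℝ} (hg : Integrable g) : Integrable fun x => holeOscillation ℓ T n x * g x :=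
  hg.bdd_mul (c := 1) (measurable_holeOscillation hn hTo).aestronglyMeasurable
    (ae_of_all _ fun x => abs_holeOscillation_le hT x)

lemma abs_integral_holeOscillation_mul_le (hT : T ⊆ cell ℓ) {g : Space N → ℝ}
    (hg : Integrable g) : |∫ x, holeOscillation ℓ T n x * g x| ≤ ∫ x, |g x| := by
  refine (abs_integral_le_integral_abs).trans ?_
  refine integral_mono_of_nonneg (ae_of_all _ fun x => abs_nonneg _) hg.abs
    (ae_of_all _ fun x => ?_)
  simp only [abs_mul]
  exact mul_le_of_le_one_left (abs_nonneg _) (abs_holeOscillation_le hT x)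

/-- Oscillations cancel against functions that are constant on the scaled cells. -/
lemma integral_holeOscillation_mul_comp_cellCorner (hℓ : ∀ i, 0 < ℓ i) (hn : 1 ≤ n)
    (hTo : IsOpen T) (hT : T ⊆ cell ℓ) {g : Space N → ℝ}
    (hg : Integrable fun x => g (cellCorner ℓ n x)) :
    ∫ x, holeOscillation ℓ T n x * g (cellCorner ℓ n x) = 0 := by
  have huniv : (⋃ k, scaledCopy ℓ n k (halfOpenCell ℓ)) = Set.univ :=
    Set.eq_univ_of_forall fun x =>
      Set.mem_iUnion.2 ⟨_, (mem_scaledCopy_halfOpenCell hℓ hn).2 rfl⟩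
  have hmeas : ∀ k, MeasurableSet (scaledCopy ℓ n k (halfOpenCell ℓ)) :=
    fun k => measurableSet_scaledCopy hn k (measurableSet_halfOpenCell ℓ)
  rw [← setIntegral_univ, ← huniv, integral_iUnion hmeas]
  · refine (tsum_congr fun k => ?_).trans tsum_zero
    have : ∀ x ∈ scaledCopy ℓ n k (halfOpenCell ℓ),
        holeOscillation ℓ T n x * g (cellCorner ℓ n x)
          = holeOscillation ℓ T n x * g ((1 / (n : ℝ)) • latticeVec ℓ k) := by
      intro x hx
      rw [cellCorner, (mem_scaledCopy_halfOpenCell hℓ hn).1 hx]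
    rw [setIntegral_congr_fun (hmeas k) this, integral_mul_const,
      setIntegral_holeOscillation hℓ hn hTo hT, zero_mul]
  · intro j k hjk
    refine Set.disjoint_left.2 fun x hj hk => hjk ?_
    rw [mem_scaledCopy_halfOpenCell hℓ hn] at hj hk
    exact hj.symm.trans hk
  · exact (integrable_holeOscillation_mul hn hTo hT hg).integrableOn

lemma tendsto_cellCorner (hℓ : ∀ i, 0 < ℓ i) (x : Space N) :
    Tendsto (fun n => cellCorner ℓ n x) atTop (𝓝 x) := by
  rw [tendsto_iff_dist_tendsto_zero]
  refine squeeze_zero' (Eventually.of_forall fun n => dist_nonneg) ?_ (tendsto_diam_div ℓ)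
  filter_upwards [eventually_ge_atTop 1] with n hn using dist_cellCorner_le hℓ hn x

/-- Passing to the corner moves a point by at most the diameter of the unscaled cell. All these
compositions therefore live on one fixed compact thickening of the support, which supplies a
dominating function. -/
lemma exists_integrable_bound_comp_cellCorner (hℓ : ∀ i, 0 < ℓ i) {g : Space N → ℝ}
    (hg : Continuous g) (hgc : HasCompactSupport g) :
    ∃ F : Space N → ℝ, Integrable F ∧
      ∀ n, 1 ≤ n → ∀ x, |g (cellCorner ℓ n x)| ≤ F x := by
  obtain ⟨C, hC⟩ := hg.bounded_above_of_compact_support hgc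
  set d := Metric.diam (halfOpenCell ℓ)
  have hK : IsCompact (Metric.cthickening d (tsupport g)) := hgc.isCompact.cthickening
  refine ⟨(Metric.cthickening d (tsupport g)).indicator fun _ => C,
    (integrable_indicator_iff hK.measurableSet).2
      (integrableOn_const hK.measure_lt_top.ne), fun n hn x => ?_⟩
  by_cases hx : x ∈ Metric.cthickening d (tsupport g)
  · rw [Set.indicator_of_mem hx]; exact hC _
  · rw [Set.indicator_of_notMem hx, abs_nonpos_iff]
    refine image_eq_zero_of_notMem_tsupport fun hmem => hx ?_
    refine Metric.mem_cthickening_of_dist_le x _ d _ hmem ?_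
    rw [dist_comm]
    refine (dist_cellCorner_le hℓ hn x).trans (div_le_self Metric.diam_nonneg ?_)
    exact_mod_cast hn

/-- Replacing `g` by its value at the cell corner costs a vanishing `L¹` error, and the oscillation
integrates to zero against the cellwise constant function that results. -/
lemma tendsto_integral_holeOscillation_of_continuous (hℓ : ∀ i, 0 < ℓ i) (hTo : IsOpen T)
    (hT : T ⊆ cell ℓ) {g : Space N → ℝ} (hg : Continuous g) (hgc : HasCompactSupport g) :
    Tendsto (fun n => ∫ x, holeOscillation ℓ T n x * g x) atTop (𝓝 0) := by
  have hgi : Integrable g := hg.integrable_of_hasCompactSupport hgc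
  obtain ⟨F, hF, hbound⟩ := exists_integrable_bound_comp_cellCorner hℓ hg hgc
  have hmeas : ∀ n, AEStronglyMeasurable (fun x => g (cellCorner ℓ n x)) volume := fun n =>
    (hg.measurable.comp (measurable_cellCorner ℓ n)).aestronglyMeasurable
  have hint : ∀ n, 1 ≤ n → Integrable fun x => g (cellCorner ℓ n x) := fun n hn =>
    hF.mono' (hmeas n) (ae_of_all _ fun x => hbound n hn x)
  have hlim : Tendsto (fun n => ∫ x, |g x - g (cellCorner ℓ n x)|) atTop (𝓝 0) := by
    rw [← integral_zero (Space N) ℝ (μ := volume)]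
    refine tendsto_integral_filter_of_dominated_convergence (fun x => |g x| + F x)
      (Eventually.of_forall fun n => (hgi.aestronglyMeasurable.sub (hmeas n)).norm) ?_
      (hgi.abs.add hF) (ae_of_all _ fun x => ?_)
    · filter_upwards [eventually_ge_atTop 1] with n hn
      refine ae_of_all _ fun x => ?_
      rw [Real.norm_eq_abs, abs_abs]
      exact (abs_sub _ _).trans (add_le_add le_rfl (hbound n hn x))
    · have h := ((hg.tendsto x).comp (tendsto_cellCorner hℓ x)).const_sub (g x)
      simpa using h.abs
  refine squeeze_zero_norm' ?_ hlim
  filter_upwards [eventually_ge_atTop 1] with n hn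
  have : ∫ x, holeOscillation ℓ T n x * g x
      = ∫ x, holeOscillation ℓ T n x * (g x - g (cellCorner ℓ n x)) := by
    simp only [mul_sub]
    rw [integral_sub (integrable_holeOscillation_mul hn hTo hT hgi)
      (integrable_holeOscillation_mul hn hTo hT (hint n hn)),
      integral_holeOscillation_mul_comp_cellCorner hℓ hn hTo hT (hint n hn), sub_zero]
  rw [this]
  exact abs_integral_holeOscillation_mul_le hT (hgi.sub (hint n hn))

/-- Density of compactly supported continuous functions in `L¹`: the oscillation is bounded by `1`,
so the approximation error is uniform in `n`. -/
lemma tendsto_integral_holeOscillation (hℓ : ∀ i, 0 < ℓ i) (hTo : IsOpen T)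
    (hT : T ⊆ cell ℓ) {g : Space N → ℝ} (hg : Integrable g) :
    Tendsto (fun n => ∫ x, holeOscillation ℓ T n x * g x) atTop (𝓝 0) := by
  rw [Metric.tendsto_nhds]
  intro ε hε
  obtain ⟨h, hhc, hgh, hh, hhi⟩ := hg.exists_hasCompactSupport_integral_sub_le (half_pos hε)
  have hlim := tendsto_integral_holeOscillation_of_continuous hℓ hTo hT hh hhc
  filter_upwards [(Metric.tendsto_nhds.1 hlim) (ε / 2) (half_pos hε), eventually_ge_atTop 1]
    with n h1 hn
  rw [Real.dist_0_eq_abs] at h1 ⊢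
  have hghi : Integrable fun x => g x - h x := hg.sub hhi
  have h2 : ∫ x, holeOscillation ℓ T n x * g x
      = (∫ x, holeOscillation ℓ T n x * (g x - h x)) + ∫ x, holeOscillation ℓ T n x * h x := by
    rw [← integral_add (integrable_holeOscillation_mul hn hTo hT hghi)
      (integrable_holeOscillation_mul hn hTo hT hhi)]
    exact integral_congr_ae (ae_of_all _ fun x => by simp only; ring)
  have h3 := abs_integral_holeOscillation_mul_le (n := n) hT (hg.sub hhi)
  simp only [Real.norm_eq_abs, Pi.sub_apply] at hgh h3
  rw [h2]
  linarith [abs_add_le (∫ x, holeOscillation ℓ T n x * (g x - h x))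
    (∫ x, holeOscillation ℓ T n x * h x)]

/-- The kept holes differ from the full periodic pattern inside `Ω` only by discarded holes. Each
point of the open set `Ω` eventually avoids these, so their contribution vanishes by dominated
convergence. -/
lemma tendstoWeakStar_localRegion (hℓ : ∀ i, 0 < ℓ i) (hTo : IsOpen T)
    (hT : closure T ⊆ cell ℓ) (hΩ : IsOpen Ω) :
    TendstoWeakStar Ω (fun n => (localRegion Ω ℓ T n).indicator (fun _ => 1))
      (fun _ => holeFraction ℓ T) := by
  intro g hg
  have hT' : T ⊆ cell ℓ := subset_closure.trans hT
  have hgi : Integrable (Ω.indicator g) := (integrable_indicator_iff hΩ.measurableSet).2 hg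
  have hD : ∀ n, 1 ≤ n → MeasurableSet (periodicHoles ℓ T n \ localRegion Ω ℓ T n) := fun n hn =>
    (measurableSet_periodicHoles hn hTo).diff (isOpen_localRegion hn hTo).measurableSet
  have hrest : Tendsto (fun n => ∫ x in Ω,
      (periodicHoles ℓ T n \ localRegion Ω ℓ T n).indicator g x) atTop (𝓝 0) := by
    rw [← integral_zero (Space N) ℝ (μ := volume.restrict Ω)]
    refine tendsto_integral_filter_of_dominated_convergence (fun x => |g x|) ?_ ?_ hg.abs ?_
    · filter_upwards [eventually_ge_atTop 1] with n hn
      exact hg.aestronglyMeasurable.indicator (hD n hn)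
    · exact Eventually.of_forall fun n => ae_of_all _ fun x => norm_indicator_le_norm_self g x
    · filter_upwards [ae_restrict_mem hΩ.measurableSet] with x hx
      refine tendsto_const_nhds.congr' ?_
      filter_upwards [eventually_notMem_periodicHoles_diff hΩ hT hx] with n hn
      rw [Set.indicator_of_notMem hn]
  have hmain := (tendsto_integral_holeOscillation hℓ hTo hT' hgi).sub hrest
  rw [sub_zero] at hmain
  -- The limit is written as zero plus `X ∫ g`, to match the vanishing oscillation and
  -- discarded-hole terms shifted by that constant.
  rw [← sub_add_cancel (∫ x in Ω, holeFraction ℓ T * g x) (∫ x in Ω, holeFraction ℓ T * g x),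
    sub_self]
  refine (hmain.add_const _).congr' ?_
  filter_upwards [eventually_ge_atTop 1] with n hn
  have h1 : ∫ x, holeOscillation ℓ T n x * Ω.indicator g x
      = ∫ x in Ω, holeOscillation ℓ T n x * g x := by
    rw [← integral_indicator hΩ.measurableSet]
    exact integral_congr_ae (ae_of_all _ fun x => (Set.indicator_mul_right _ _ _).symm)
  have hosc : IntegrableOn (fun x => holeOscillation ℓ T n x * g x) Ω :=
    Integrable.bdd_mul (c := 1) hg (measurable_holeOscillation hn hTo).aestronglyMeasurable
      (ae_of_all _ fun x => abs_holeOscillation_le hT' x)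
  have hdiff : IntegrableOn (fun x => holeOscillation ℓ T n x * g x
      - (periodicHoles ℓ T n \ localRegion Ω ℓ T n).indicator g x) Ω :=
    hosc.sub (hg.indicator (hD n hn))
  rw [h1, ← integral_sub hosc (hg.indicator (hD n hn)),
    ← integral_add hdiff (hg.const_mul _)]
  refine integral_congr_ae (ae_of_all _ fun x => ?_)
  have hsub := localRegion_subset_periodicHoles (Ω := Ω) (ℓ := ℓ) (T := T) (n := n)
  by_cases hA : x ∈ localRegion Ω ℓ T n
  · simp [holeOscillation, hA, hsub hA]
    ring
  · by_cases hP : x ∈ periodicHoles ℓ T n <;> simp [holeOscillation, hA, hP] <;> ring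

lemma tendstoWeakStar_nonlocalRegion (hℓ : ∀ i, 0 < ℓ i) (hTo : IsOpen T)
    (hT : closure T ⊆ cell ℓ) (hΩ : IsOpen Ω) :
    TendstoWeakStar Ω (fun n => (nonlocalRegion Ω ℓ T n).indicator (fun _ => 1))
      (fun _ => 1 - holeFraction ℓ T) := by
  intro g hg
  have h := (tendstoWeakStar_localRegion hℓ hTo hT hΩ g hg).const_sub (∫ x in Ω, g x)
  have h2 : ∫ x in Ω, (1 - holeFraction ℓ T) * g x
      = (∫ x in Ω, g x) - ∫ x in Ω, holeFraction ℓ T * g x := by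
    rw [← integral_sub hg (hg.const_mul _)]
    exact integral_congr_ae (ae_of_all _ fun x => by simp only; ring)
  rw [h2]
  refine h.congr' ?_
  filter_upwards [eventually_ge_atTop 1] with n hn
  have hA := (isOpen_localRegion (Ω := Ω) (ℓ := ℓ) hn hTo).measurableSet
  have hi : IntegrableOn (fun x => (localRegion Ω ℓ T n).indicator (fun _ => (1 : ℝ)) x * g x) Ω := by
    refine (hg.indicator hA).congr (ae_of_all _ fun x => ?_)
    by_cases hx : x ∈ localRegion Ω ℓ T n <;> simp [hx]
  rw [← integral_sub hg hi]
  refine setIntegral_congr_fun hΩ.measurableSet fun x hx => ?_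
  by_cases hxA : x ∈ localRegion Ω ℓ T n <;> simp [nonlocalRegion, hxA, hx]

end Geometry

/-! ### A uniform Poincaré inequality for the coupling energy -/

section Coercivity

open scoped ENNReal

/-- The mean square difference of `w` between the measures `μ` and `ν`. -/
noncomputable def crossVariation {α : Type*} [MeasurableSpace α] (μ ν : Measure α) (w : α → ℝ) :
    ℝ≥0∞ :=
  ∫⁻ x, ∫⁻ y, ENNReal.ofReal ((w y - w x) ^ 2) ∂ν ∂μ

section CrossVariation

variable {α : Type*} [MeasurableSpace α] {μ ν ρ : Measure α} {w : α → ℝ}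

lemma measurable_ofReal_sub_sq (hw : Measurable w) :
    Measurable (Function.uncurry fun x y => ENNReal.ofReal ((w y - w x) ^ 2)) :=
  (((hw.comp measurable_snd).sub (hw.comp measurable_fst)).pow_const 2).ennreal_ofReal

lemma crossVariation_comm [SFinite μ] [SFinite ν] (hw : Measurable w) :
    crossVariation μ ν w = crossVariation ν μ w := by
  unfold crossVariation
  rw [lintegral_lintegral_swap (measurable_ofReal_sub_sq hw).aemeasurable]
  simp only [sub_sq_comm]

/-- A triangle inequality through an intermediate point `z`: the bound `(w y - w x)² ≤ 2 (w z - w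
x)² + 2 (w y - w z)²` is averaged over `z` with respect to `ν`. The mass of `ν` on the left is why
intermediate sets must have volume bounded below. -/
lemma crossVariation_trans [SFinite μ] [SFinite ν] [SFinite ρ] (hw : Measurable w) :
    ν Set.univ * crossVariation μ ρ w ≤
      2 * (ρ Set.univ * crossVariation μ ν w) + 2 * (μ Set.univ * crossVariation ν ρ w) := by
  have hF := measurable_ofReal_sub_sq hw
  set F : α → α → ℝ≥0∞ := fun x y => ENNReal.ofReal ((w y - w x) ^ 2) with hFdef
  have hF1 : ∀ x, Measurable (F x) := fun x => hF.comp measurable_prodMk_left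
  have hF2 : ∀ y, Measurable fun x => F x y := fun y => hF.comp measurable_prodMk_right
  have hint : ∀ σ : Measure α, SFinite σ → Measurable fun x => ∫⁻ y, F x y ∂σ :=
    fun σ _ => hF.lintegral_prod_right'
  have hint2 : ∀ σ : Measure α, SFinite σ → Measurable fun y => ∫⁻ x, F x y ∂σ :=
    fun σ _ => hF.lintegral_prod_left'
  have hpt : ∀ x y, ν Set.univ * F x y ≤ 2 * (∫⁻ z, F x z ∂ν) + 2 * ∫⁻ z, F z y ∂ν := by
    intro x y
    rw [mul_comm, ← lintegral_const, ← lintegral_const_mul _ (hF1 x),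
      ← lintegral_const_mul _ (hF2 y), ← lintegral_add_left ((hF1 x).const_mul _)]
    refine lintegral_mono fun z => ?_
    have h2 : (2 : ℝ≥0∞) = ENNReal.ofReal 2 := by simp
    simp only [hFdef]
    rw [h2, ← ENNReal.ofReal_mul zero_le_two, ← ENNReal.ofReal_mul zero_le_two,
      ← ENNReal.ofReal_add (by positivity) (by positivity)]
    exact ENNReal.ofReal_le_ofReal (by nlinarith [sq_nonneg ((w y - w z) - (w z - w x))])
  calc ν Set.univ * crossVariation μ ρ w
      = ∫⁻ x, ∫⁻ y, ν Set.univ * F x y ∂ρ ∂μ := by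
        simp only [lintegral_const_mul _ (hF1 _)]
        rw [lintegral_const_mul _ (hint ρ inferInstance)]
        rfl
    _ ≤ ∫⁻ x, ∫⁻ y, (2 * (∫⁻ z, F x z ∂ν) + 2 * ∫⁻ z, F z y ∂ν) ∂ρ ∂μ :=
        lintegral_mono fun x => lintegral_mono fun y => hpt x y
    _ = 2 * (ρ Set.univ * crossVariation μ ν w) + 2 * (μ Set.univ * crossVariation ν ρ w) := by
        have h1 : ∀ x, ∫⁻ y, (2 * (∫⁻ z, F x z ∂ν) + 2 * ∫⁻ z, F z y ∂ν) ∂ρ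
            = 2 * (ρ Set.univ * ∫⁻ z, F x z ∂ν) + 2 * ∫⁻ y, ∫⁻ z, F z y ∂ν ∂ρ := by
          intro x
          rw [lintegral_add_left measurable_const, lintegral_const,
            lintegral_const_mul _ (hint2 ν inferInstance)]
          ring
        simp only [h1]
        rw [lintegral_add_right _ measurable_const, lintegral_const,
          lintegral_const_mul _ ((hint ν inferInstance).const_mul _),
          lintegral_const_mul _ (hint ν inferInstance),
          ← lintegral_lintegral_swap (μ := ν) (ν := ρ) hF.aemeasurable]
        simp only [crossVariation]
        ring

end CrossVariation

variable {N : ℕ}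

/-- The nonlocal coupling energy of `w` between `A` and `B`. -/
noncomputable def couplingEnergy (J : Space N → ℝ) (A B : Set (Space N)) (w : Space N → ℝ) :
    ℝ≥0∞ :=
  ∫⁻ x in A, ∫⁻ y in B, ENNReal.ofReal (J (x - y) * (w y - w x) ^ 2)

/-- The cross variation between `S n` and `S' n` is controlled by the energy, uniformly in `n`. -/
def IsControlled (E : ℕ → (Space N → ℝ) → ℝ≥0∞) (S S' : ℕ → Set (Space N)) : Prop :=
  ∃ C : ℝ≥0∞, C ≠ ⊤ ∧ ∀ᶠ n in atTop, ∀ w : Space N → ℝ, Measurable w →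
    crossVariation (volume.restrict (S n)) (volume.restrict (S' n)) w ≤ C * E n w

namespace IsControlled

variable {E : ℕ → (Space N → ℝ) → ℝ≥0∞} {S S' S'' : ℕ → Set (Space N)}

lemma symm (h : IsControlled E S S') : IsControlled E S' S := by
  obtain ⟨C, hC, h⟩ := h
  refine ⟨C, hC, h.mono fun n hn w hw => ?_⟩
  rw [crossVariation_comm hw]
  exact hn w hw

/-- Control can be chained with a constant independent of `n`, as long as the intermediate sets keep
a volume of at least `η`. -/
lemma trans (h : IsControlled E S S') (h' : IsControlled E S' S'') {M η : ℝ≥0∞} (hM : M ≠ ⊤)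
    (hη : η ≠ 0) (hSM : ∀ n, volume (S n) ≤ M) (hSM' : ∀ n, volume (S'' n) ≤ M)
    (hSη : ∀ᶠ n in atTop, η ≤ volume (S' n)) : IsControlled E S S'' := by
  obtain ⟨C, hC, h⟩ := h
  obtain ⟨C', hC', h'⟩ := h'
  -- Truncation at `1` rules out `η = ⊤`, so that dividing by it is legitimate.
  have hmin0 : min η 1 ≠ 0 := by simp [min_eq_iff, hη]
  have hmint : min η 1 ≠ ⊤ := ne_top_of_le_ne_top ENNReal.one_ne_top (min_le_right _ _)
  refine ⟨(min η 1)⁻¹ * (2 * (M * C) + 2 * (M * C')), ?_, ?_⟩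
  · exact ENNReal.mul_ne_top (ENNReal.inv_ne_top.2 hmin0) (by finiteness)
  filter_upwards [h, h', hSη] with n h1 h2 h3 w hw
  have key := crossVariation_trans (μ := volume.restrict (S n)) (ν := volume.restrict (S' n))
    (ρ := volume.restrict (S'' n)) hw
  simp only [Measure.restrict_apply_univ] at key
  rw [mul_assoc, ← ENNReal.div_eq_inv_mul, ENNReal.le_div_iff_mul_le (Or.inl hmin0) (Or.inl hmint),
    mul_comm]
  calc min η 1 * crossVariation (volume.restrict (S n)) (volume.restrict (S'' n)) w
      ≤ volume (S' n) * crossVariation (volume.restrict (S n)) (volume.restrict (S'' n)) w := by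
        gcongr
        exact (min_le_left _ _).trans h3
    _ ≤ _ := key
    _ ≤ 2 * (M * (C * E n w)) + 2 * (M * (C' * E n w)) := by
        gcongr
        exacts [hSM' n, h1 w hw, hSM n, h2 w hw]
    _ = (2 * (M * C) + 2 * (M * C')) * E n w := by ring

lemma mono_right (h : IsControlled E S S'') (hS : ∀ᶠ n in atTop, S' n ⊆ S'' n) :
    IsControlled E S S' := by
  obtain ⟨C, hC, h⟩ := h
  refine ⟨C, hC, ?_⟩
  filter_upwards [h, hS] with n h1 h2 w hw
  refine le_trans (lintegral_mono fun x => ?_) (h1 w hw)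
  exact lintegral_mono_set h2

lemma empty_right : IsControlled E S fun _ => ∅ :=
  ⟨0, by simp, Eventually.of_forall fun n w _ => by simp [crossVariation]⟩

lemma union_right (h : IsControlled E S S') (h' : IsControlled E S S'') :
    IsControlled E S fun n => S' n ∪ S'' n := by
  obtain ⟨C, hC, h⟩ := h
  obtain ⟨C', hC', h'⟩ := h'
  refine ⟨C + C', by finiteness, ?_⟩
  filter_upwards [h, h'] with n h1 h2 w hw
  rw [add_mul]
  refine le_trans ?_ (add_le_add (h1 w hw) (h2 w hw))
  unfold crossVariation
  have hm : Measurable fun x => ∫⁻ y in S' n, ENNReal.ofReal ((w y - w x) ^ 2) :=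
    (measurable_ofReal_sub_sq hw).lintegral_prod_right'
  rw [← lintegral_add_left hm]
  exact lintegral_mono fun x => lintegral_union_le _ _ _

lemma biUnion_right {ι : Type*} {t : Set ι} (ht : t.Finite) {U : ι → ℕ → Set (Space N)}
    (h : ∀ i ∈ t, IsControlled E S (U i)) : IsControlled E S fun n => ⋃ i ∈ t, U i n := by
  induction t, ht using Set.Finite.induction_on with
  | empty => simpa using empty_right
  | insert _ _ ih =>
    simp only [Set.biUnion_insert]
    exact (h _ (Set.mem_insert _ _)).union_right
      (ih fun i hi => h i (Set.mem_insert_of_mem _ hi))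

end IsControlled

variable {J : Space N → ℝ} {Ω : Set (Space N)} {A B : ℕ → Set (Space N)}

/-- The elementary link of the chains: on `Q × Q'` the kernel is at least `c`, so the energy
dominates `c` times the variation. Only links from `A` to `B` arise in this way. -/
lemma isControlled_of_dist_lt {c δ : ℝ} (hc : 0 < c) (hJ : ∀ z, ‖z‖ < δ → c ≤ J z)
    (hA : ∀ᶠ n in atTop, MeasurableSet (A n)) (hB : ∀ᶠ n in atTop, MeasurableSet (B n))
    {Q Q' : Set (Space N)} (hQm : MeasurableSet Q) (hQm' : MeasurableSet Q')
    (hQ : ∀ x ∈ Q, ∀ y ∈ Q', dist x y < δ) :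
    IsControlled (fun n => couplingEnergy J (A n) (B n)) (fun n => Q ∩ A n) fun n => Q' ∩ B n := by
  refine ⟨(ENNReal.ofReal c)⁻¹, ENNReal.inv_ne_top.2 (by simpa using hc), ?_⟩
  filter_upwards [hA, hB] with n hAn hBn w hw
  have hF := measurable_ofReal_sub_sq hw
  rw [← ENNReal.div_eq_inv_mul, ENNReal.le_div_iff_mul_le (Or.inl (by simpa using hc))
    (Or.inl ENNReal.ofReal_ne_top), mul_comm]
  have hm : Measurable fun x => ∫⁻ y in Q' ∩ B n, ENNReal.ofReal ((w y - w x) ^ 2) :=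
    hF.lintegral_prod_right'
  unfold crossVariation
  rw [← lintegral_const_mul _ hm]
  refine le_trans (setLIntegral_mono' (hQm.inter hAn) fun x hx => ?_)
    (lintegral_mono_set Set.inter_subset_right)
  have hm' : Measurable fun y => ENNReal.ofReal ((w y - w x) ^ 2) :=
    hF.comp measurable_prodMk_left
  rw [← lintegral_const_mul _ hm']
  refine le_trans (setLIntegral_mono' (hQm'.inter hBn) fun y hy => ?_)
    (lintegral_mono_set Set.inter_subset_right)
  rw [← ENNReal.ofReal_mul hc.le]
  refine ENNReal.ofReal_le_ofReal (mul_le_mul_of_nonneg_right (hJ _ ?_) (sq_nonneg _))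
  rw [← dist_eq_norm]
  exact hQ x hx.1 y hy.1

/-- If the coupling kernel is positive near the origin, `Ω` is connected, and both phases occupy
a fixed amount of each ball centred in `Ω`, then the coupling energy controls the variation. -/
theorem exists_crossVariation_le (hΩ_conn : IsPreconnected Ω) (hΩ_bdd : Bornology.IsBounded Ω)
    (hJ : Continuous J) (hJ0 : 0 < J 0)
    (hA : ∀ᶠ n in atTop, MeasurableSet (A n)) (hB : ∀ᶠ n in atTop, MeasurableSet (B n))
    (hAB : ∀ n, A n ∪ B n = Ω)
    (hAη : ∀ x ∈ Ω, ∀ r > 0, ∃ η : ℝ≥0∞, η ≠ 0 ∧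
      ∀ᶠ n in atTop, η ≤ volume (Metric.ball x r ∩ A n))
    (hBη : ∀ x ∈ Ω, ∀ r > 0, ∃ η : ℝ≥0∞, η ≠ 0 ∧
      ∀ᶠ n in atTop, η ≤ volume (Metric.ball x r ∩ B n)) :
    IsControlled (fun n => couplingEnergy J (A n) (B n)) (fun _ => Ω) fun _ => Ω := by
  obtain ⟨δ, hδ, hJδ⟩ := Metric.continuousAt_iff.1 hJ.continuousAt (J 0 / 2) (half_pos hJ0)
  have hJc : ∀ z, ‖z‖ < δ → J 0 / 2 ≤ J z := by
    intro z hz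
    have h : dist (J z) (J 0) < J 0 / 2 := hJδ (by rwa [dist_zero_right])
    rw [Real.dist_eq, abs_lt] at h
    linarith [h.1]
  -- Points of two balls of radius `r` whose centres are less than `r` apart have distance below `3r
  -- < δ`.
  set r := δ / 4 with hr
  have hr0 : 0 < r := by positivity
  let E := fun n => couplingEnergy J (A n) (B n)
  have hM : volume Ω ≠ ⊤ := hΩ_bdd.measure_lt_top.ne
  have hAΩ : ∀ n, A n ⊆ Ω := fun n => (Set.subset_union_left).trans (hAB n).subset
  have hBΩ : ∀ n, B n ⊆ Ω := fun n => (Set.subset_union_right).trans (hAB n).subset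
  have hMA : ∀ (x : Space N) n, volume (Metric.ball x r ∩ A n) ≤ volume Ω := fun x n =>
    measure_mono (Set.inter_subset_right.trans (hAΩ n))
  have hMB : ∀ (x : Space N) n, volume (Metric.ball x r ∩ B n) ≤ volume Ω := fun x n =>
    measure_mono (Set.inter_subset_right.trans (hBΩ n))
  have hnear : ∀ x y : Space N, dist x y < r →
      IsControlled E (fun n => Metric.ball x r ∩ A n) fun n => Metric.ball y r ∩ B n := by
    intro x y hxy
    have hdist : ∀ a ∈ Metric.ball x r, ∀ b ∈ Metric.ball y r, dist a b < δ := ?_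
    · exact isControlled_of_dist_lt (half_pos hJ0) hJc hA hB measurableSet_ball
        measurableSet_ball hdist
    intro a ha b hb
    rw [Metric.mem_ball] at ha hb
    have h1 := dist_triangle4 a x y b
    rw [dist_comm y b] at h1
    linarith
  have hAA : ∀ x ∈ Ω, ∀ y ∈ Ω,
      IsControlled E (fun n => Metric.ball x r ∩ A n) fun n => Metric.ball y r ∩ A n := by
    intro x hx y hy
    -- On a connected set, a symmetric and transitive relation that holds locally holds everywhere.
    -- Locally, the energy couples `A` only to `B`, so the path from `A` near `x` to `A` near `y`
    -- passes through `B` near `x`; transitivity passes through `A` near the middle point.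
    refine hΩ_conn.induction₂ (fun x y =>
      IsControlled E (fun n => Metric.ball x r ∩ A n) fun n => Metric.ball y r ∩ A n)
      ?_ ?_ (fun _ _ _ _ h => h.symm) hx hy
    · intro x hx
      obtain ⟨η, hη, hle⟩ := hBη x hx r hr0
      filter_upwards [mem_nhdsWithin_of_mem_nhds (Metric.ball_mem_nhds x hr0)] with y hy
      exact (hnear x x (by simpa using hr0)).trans (hnear y x hy).symm hM hη (hMA x) (hMA y) hle
    · intro x y z _ hy _ hxy hyz
      obtain ⟨η, hη, hle⟩ := hAη y hy r hr0
      exact hxy.trans hyz hM hη (hMA x) (hMA z) hle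
  have hAB' : ∀ x ∈ Ω, ∀ y ∈ Ω,
      IsControlled E (fun n => Metric.ball x r ∩ A n) fun n => Metric.ball y r ∩ B n := by
    intro x hx y hy
    obtain ⟨η, hη, hle⟩ := hAη y hy r hr0
    exact (hAA x hx y hy).trans (hnear y y (by simpa using hr0)) hM hη (hMA x) (hMB y) hle
  have hBB : ∀ x ∈ Ω, ∀ y ∈ Ω,
      IsControlled E (fun n => Metric.ball x r ∩ B n) fun n => Metric.ball y r ∩ B n := by
    intro x hx y hy
    obtain ⟨η, hη, hle⟩ := hAη x hx r hr0
    exact (hAB' x hx x hx).symm.trans (hAB' x hx y hy) hM hη (hMB x) (hMB y) hle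
  obtain ⟨t, htΩ, ht, hcover⟩ := Metric.finite_approx_of_totallyBounded
    (hΩ_bdd.isCompact_closure.totallyBounded.subset subset_closure) r hr0
  have hcov : ∀ n, Ω ⊆ ⋃ x ∈ t, (Metric.ball x r ∩ A n) ∪ (Metric.ball x r ∩ B n) := by
    intro n y hy
    obtain ⟨x, hx, hyx⟩ := Set.mem_iUnion₂.1 (hcover hy)
    refine Set.mem_iUnion₂.2 ⟨x, hx, ?_⟩
    rw [← Set.inter_union_distrib_left, hAB]
    exact ⟨hyx, hy⟩
  -- Finitely many balls cover `Ω`, so control of both phases in each ball adds up to control on all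
  -- of `Ω`.
  have hglue : ∀ S : ℕ → Set (Space N),
      (∀ x ∈ t, IsControlled E S fun n => Metric.ball x r ∩ A n) →
      (∀ x ∈ t, IsControlled E S fun n => Metric.ball x r ∩ B n) →
      IsControlled E S fun _ => Ω := fun S h1 h2 =>
    (IsControlled.biUnion_right ht fun x hx => (h1 x hx).union_right (h2 x hx)).mono_right
      (Eventually.of_forall hcov)
  -- The covering is summed in both arguments, with symmetry exchanging their roles.
  exact hglue _
    (fun x hx => (hglue _ (fun y hy => hAA x (htΩ hx) y (htΩ hy))
      fun y hy => hAB' x (htΩ hx) y (htΩ hy)).symm)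
    (fun x hx => (hglue _ (fun y hy => (hAB' y (htΩ hy) x (htΩ hx)).symm)
      fun y hy => hBB x (htΩ hx) y (htΩ hy)).symm)

end Coercivity

/-! ### Kernels acting on `L²` functions -/

section Kernel

variable {N : ℕ} {K : Space N → ℝ} {A B Ω : Set (Space N)}

lemma IsKernel.symm (hK : IsKernel K) (x y : Space N) : K (x - y) = K (y - x) :=
  hK.radial _ _ (norm_sub_rev x y)

lemma IsKernel.exists_bound (hK : IsKernel K) : ∃ M, 0 ≤ M ∧ ∀ z, |K z| ≤ M := by
  obtain ⟨M, hM⟩ := hK.continuous.bounded_above_of_compact_support hK.hasCompactSupport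
  exact ⟨M, (norm_nonneg _).trans (hM 0), hM⟩

lemma IsKernel.integrable_mul (hK : IsKernel K) {μ ν : Measure (Space N)} [SFinite ν]
    {h : Space N × Space N → ℝ} (hh : Integrable h (μ.prod ν)) :
    Integrable (fun p => K (p.1 - p.2) * h p) (μ.prod ν) := by
  obtain ⟨M, -, hM⟩ := hK.exists_bound
  exact hh.bdd_mul (c := M)
    (hK.continuous.comp (continuous_fst.sub continuous_snd)).measurable.aestronglyMeasurable
    (ae_of_all _ fun p => hM _)

lemma IsKernel.integrable_mul_right (hK : IsKernel K) {ν : Measure (Space N)} (x : Space N)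
    {h : Space N → ℝ} (hh : Integrable h ν) : Integrable (fun y => K (x - y) * h y) ν := by
  obtain ⟨M, -, hM⟩ := hK.exists_bound
  exact hh.bdd_mul (c := M)
    (hK.continuous.comp (continuous_const.sub continuous_id)).measurable.aestronglyMeasurable
    (ae_of_all _ fun p => hM _)

lemma integrable_sub_mul_sub {α : Type*} [MeasurableSpace α] {μ ν : Measure α}
    [IsFiniteMeasure μ] [IsFiniteMeasure ν] {a c b d : α → ℝ} (ha : MemLp a 2 ν)
    (hc : MemLp c 2 ν) (hb : MemLp b 2 μ) (hd : MemLp d 2 μ) :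
    Integrable (fun p : α × α => (a p.2 - b p.1) * (c p.2 - d p.1)) (μ.prod ν) := by
  have ha' := ha.integrable one_le_two
  have hb' := hb.integrable one_le_two
  have hc' := hc.integrable one_le_two
  have hd' := hd.integrable one_le_two
  have h1 : Integrable (fun p : α × α => a p.2 * c p.2) (μ.prod ν) :=
    (ha.integrable_mul hc).comp_snd μ
  have h2 : Integrable (fun p : α × α => b p.1 * d p.1) (μ.prod ν) :=
    (hb.integrable_mul hd).comp_fst ν
  refine (((h1.add h2).sub (hd'.mul_prod ha')).sub (hb'.mul_prod hc')).congr
    (ae_of_all _ fun p => ?_)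
  simp only [Pi.add_apply, Pi.sub_apply]
  ring

lemma integrable_sub_mul_left {α : Type*} [MeasurableSpace α] {μ ν : Measure α}
    [IsFiniteMeasure μ] [IsFiniteMeasure ν] {a b d : α → ℝ} (ha : MemLp a 2 ν)
    (hb : MemLp b 2 μ) (hd : MemLp d 2 μ) :
    Integrable (fun p : α × α => (a p.2 - b p.1) * d p.1) (μ.prod ν) := by
  refine (integrable_sub_mul_sub ha (memLp_const 0) hb hd).neg.congr (ae_of_all _ fun p => ?_)
  simp

lemma integrable_sub_mul_right {α : Type*} [MeasurableSpace α] {μ ν : Measure α}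
    [IsFiniteMeasure μ] [IsFiniteMeasure ν] {a b c : α → ℝ} (ha : MemLp a 2 ν)
    (hc : MemLp c 2 ν) (hb : MemLp b 2 μ) :
    Integrable (fun p : α × α => (a p.2 - b p.1) * c p.2) (μ.prod ν) := by
  refine (integrable_sub_mul_sub ha hc hb (memLp_const 0)).congr (ae_of_all _ fun p => ?_)
  simp

section Pairing

variable {μ ν : Measure (Space N)} [IsFiniteMeasure μ] [IsFiniteMeasure ν]
  {a b φ ψ : Space N → ℝ}

lemma IsKernel.integrable_mul_integral (hK : IsKernel K) (ha : MemLp a 2 ν) (hb : MemLp b 2 μ)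
    (hφ : MemLp φ 2 μ) :
    Integrable (fun x => φ x * ∫ y, K (x - y) * (a y - b x) ∂ν) μ := by
  refine (hK.integrable_mul (integrable_sub_mul_left ha hb hφ)).integral_prod_left.congr
    (ae_of_all _ fun x => ?_)
  simp only
  rw [← integral_const_mul]
  exact integral_congr_ae (ae_of_all _ fun y => by simp only; ring)

/-- Fubini's theorem for the coupling term. -/
lemma IsKernel.integral_pairing (hK : IsKernel K) (ha : MemLp a 2 ν) (hb : MemLp b 2 μ)
    (hφ : MemLp φ 2 μ) (hψ : MemLp ψ 2 ν) :
    ∫ x, ∫ y, K (x - y) * (a y - b x) * (ψ y - φ x) ∂ν ∂μ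
      = - (∫ x, φ x * ∫ y, K (x - y) * (a y - b x) ∂ν ∂μ)
        - ∫ x, ψ x * ∫ y, K (x - y) * (b y - a x) ∂μ ∂ν := by
  have h1 := hK.integrable_mul (integrable_sub_mul_left ha hb hφ)
  have h2 := hK.integrable_mul (integrable_sub_mul_right ha hψ hb)
  have e1 : ∫ x, φ x * ∫ y, K (x - y) * (a y - b x) ∂ν ∂μ
      = ∫ p, K (p.1 - p.2) * ((a p.2 - b p.1) * φ p.1) ∂(μ.prod ν) := by
    rw [integral_prod _ h1]
    simp only [← integral_const_mul]
    exact integral_congr_ae (ae_of_all _ fun x => integral_congr_ae (ae_of_all _ fun y => by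
      simp only; ring))
  have e2 : ∫ x, ψ x * ∫ y, K (x - y) * (b y - a x) ∂μ ∂ν
      -- Exchanging the variables reverses the sign of the difference and leaves the radial kernel
      -- unchanged.
      = - ∫ p, K (p.1 - p.2) * ((a p.2 - b p.1) * ψ p.2) ∂(μ.prod ν) := by
    rw [integral_prod_symm _ h2, ← integral_neg]
    refine integral_congr_ae (ae_of_all _ fun x => ?_)
    simp only
    rw [← integral_const_mul, ← integral_neg]
    exact integral_congr_ae (ae_of_all _ fun y => by simp only; rw [hK.symm x y]; ring)
  have e3 : ∫ x, ∫ y, K (x - y) * (a y - b x) * (ψ y - φ x) ∂ν ∂μ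
      = ∫ p, (K (p.1 - p.2) * ((a p.2 - b p.1) * ψ p.2)
        - K (p.1 - p.2) * ((a p.2 - b p.1) * φ p.1)) ∂(μ.prod ν) := by
    refine Eq.trans ?_ (integral_prod _ (h2.sub h1)).symm
    exact integral_congr_ae (ae_of_all _ fun x => integral_congr_ae (ae_of_all _ fun y => by
      simp only [Pi.sub_apply]; ring))
  rw [e1, e2, e3, integral_sub h2 h1]
  ring

lemma IsKernel.integral_pairing_add (hK : IsKernel K) {a' b' : Space N → ℝ} (ha : MemLp a 2 ν)
    (hb : MemLp b 2 μ) (ha' : MemLp a' 2 ν) (hb' : MemLp b' 2 μ)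
    (hφ : MemLp φ 2 μ) (hψ : MemLp ψ 2 ν) :
    ∫ x, ∫ y, K (x - y) * ((a y + a' y) - (b x + b' x)) * (ψ y - φ x) ∂ν ∂μ
      = (∫ x, ∫ y, K (x - y) * (a y - b x) * (ψ y - φ x) ∂ν ∂μ)
        + ∫ x, ∫ y, K (x - y) * (a' y - b' x) * (ψ y - φ x) ∂ν ∂μ := by
  have h1 := hK.integrable_mul (integrable_sub_mul_sub ha hψ hb hφ)
  have h2 := hK.integrable_mul (integrable_sub_mul_sub ha' hψ hb' hφ)
  simp only [← mul_assoc] at h1 h2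
  have e1 := integral_prod _ h1
  have e2 := integral_prod _ h2
  have e3 := integral_prod _ (h1.add h2)
  rw [← e1, ← e2, ← integral_add h1 h2]
  refine Eq.trans ?_ e3.symm
  refine integral_congr_ae (ae_of_all _ fun x => integral_congr_ae (ae_of_all _ fun y => ?_))
  simp only [Pi.add_apply]
  ring

lemma IsKernel.ofReal_integral_mul_sq (hK : IsKernel K) {w : Space N → ℝ} (hwν : MemLp w 2 ν)
    (hwμ : MemLp w 2 μ) (hw : Measurable w) :
    ENNReal.ofReal (∫ x, ∫ y, K (x - y) * (w y - w x) ^ 2 ∂ν ∂μ)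
      = ∫⁻ x, ∫⁻ y, ENNReal.ofReal (K (x - y) * (w y - w x) ^ 2) ∂ν ∂μ := by
  have h1 := hK.integrable_mul (integrable_sub_mul_sub hwν hwν hwμ hwμ)
  simp only [← pow_two] at h1
  have hm : Measurable fun p : Space N × Space N =>
      ENNReal.ofReal (K (p.1 - p.2) * (w p.2 - w p.1) ^ 2) :=
    ((hK.continuous.measurable.comp (measurable_fst.sub measurable_snd)).mul
      (((hw.comp measurable_snd).sub (hw.comp measurable_fst)).pow_const 2)).ennreal_ofReal
  rw [← lintegral_prod (fun p : Space N × Space N =>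
      ENNReal.ofReal (K (p.1 - p.2) * (w p.2 - w p.1) ^ 2)) hm.aemeasurable,
    ← ofReal_integral_eq_lintegral_ofReal h1
      (ae_of_all _ fun p => mul_nonneg (hK.nonneg _) (sq_nonneg _)), integral_prod _ h1]

end Pairing

/-- The variance identity: when the square is expanded, the cross term vanishes by the mean-zero
condition and each remaining square contributes the total mass times `∫ w²`. -/
lemma ofReal_integral_sub_sq {α : Type*} [MeasurableSpace α] {μ : Measure α} [IsFiniteMeasure μ]
    {w : α → ℝ} (hw : MemLp w 2 μ) (hwm : Measurable w) (h0 : ∫ x, w x ∂μ = 0) :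
    ENNReal.ofReal (2 * μ.real Set.univ * ∫ x, w x ^ 2 ∂μ) = crossVariation μ μ w := by
  have h1 := integrable_sub_mul_sub hw hw hw hw
  simp only [← pow_two] at h1
  have hm : Measurable fun p : α × α => ENNReal.ofReal ((w p.2 - w p.1) ^ 2) :=
    measurable_ofReal_sub_sq hwm
  rw [crossVariation, ← lintegral_prod (fun p : α × α => ENNReal.ofReal ((w p.2 - w p.1) ^ 2))
      hm.aemeasurable, ← ofReal_integral_eq_lintegral_ofReal h1
      (ae_of_all _ fun p => sq_nonneg _), integral_prod _ h1]
  congr 1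
  have hw1 := hw.integrable one_le_two
  have hw2 : Integrable (fun x => w x ^ 2) μ := hw.integrable_sq
  have hin : ∀ x, ∫ y, (w y - w x) ^ 2 ∂μ
      = (∫ y, w y ^ 2 ∂μ) + μ.real Set.univ * w x ^ 2 := by
    intro x
    have : ∀ y, (w y - w x) ^ 2 = w y ^ 2 - 2 * w x * w y + w x ^ 2 := fun y => by ring
    have hsub : Integrable (fun y => w y ^ 2 - 2 * w x * w y) μ := hw2.sub (hw1.const_mul _)
    simp only [this]
    rw [integral_add hsub (integrable_const _),
      integral_sub hw2 (hw1.const_mul _), integral_const_mul, h0, integral_const]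
    simp
  simp only [hin]
  rw [integral_add (integrable_const _) (hw2.const_mul _), integral_const_mul, integral_const,
    smul_eq_mul]
  ring

lemma setIntegral_setIntegral_congr {F H : Space N → ℝ} (k : Space N → Space N → ℝ → ℝ → ℝ)
    (hA : F =ᵐ[volume.restrict A] H) (hB : F =ᵐ[volume.restrict B] H) :
    ∫ x in A, ∫ y in B, k x y (F x) (F y) = ∫ x in A, ∫ y in B, k x y (H x) (H y) := by
  refine integral_congr_ae ?_
  filter_upwards [hA] with x hx
  refine integral_congr_ae ?_
  filter_upwards [hB] with y hy
  rw [hx, hy]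

/-- The uniform Poincaré inequality in `L²(Ω)`. -/
theorem IsKernel.exists_integral_sq_le {J : Space N → ℝ} (hJ : IsKernel J)
    {A B : ℕ → Set (Space N)} (hΩ_bdd : Bornology.IsBounded Ω) (hΩ_pos : volume Ω ≠ 0)
    (hA : ∀ n, A n ⊆ Ω) (hB : ∀ n, B n ⊆ Ω)
    (h : IsControlled (fun n => couplingEnergy J (A n) (B n)) (fun _ => Ω) fun _ => Ω) :
    ∃ C : ℝ, 0 < C ∧ ∀ᶠ n in atTop, ∀ w : Space N → ℝ, MemLp w 2 (volume.restrict Ω) →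
      ∫ x in Ω, w x = 0 →
      ∫ x in Ω, w x ^ 2 ≤ C * ∫ x in A n, ∫ y in B n, J (x - y) * (w y - w x) ^ 2 := by
  obtain ⟨C, hC, h⟩ := h
  have hΩt : volume Ω ≠ ⊤ := hΩ_bdd.measure_lt_top.ne
  have : IsFiniteMeasure (volume.restrict Ω) := isFiniteMeasure_restrict.2 hΩt
  have hAf : ∀ n, IsFiniteMeasure (volume.restrict (A n)) := fun n =>
    isFiniteMeasure_restrict.2 (measure_ne_top_of_subset (hA n) hΩt)
  have hBf : ∀ n, IsFiniteMeasure (volume.restrict (B n)) := fun n =>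
    isFiniteMeasure_restrict.2 (measure_ne_top_of_subset (hB n) hΩt)
  have hV : 0 < volume.real Ω := ENNReal.toReal_pos hΩ_pos hΩt
  -- The denominator comes from the variance identity; adding `1` keeps the constant positive even
  -- if `C = 0`.
  refine ⟨(C.toReal + 1) / (2 * volume.real Ω), by positivity, ?_⟩
  filter_upwards [h] with n hn w hw h0
  -- `IsControlled` concerns measurable functions, so `w` is replaced by a measurable
  -- representative; none of the integrals changes.
  set w' := hw.1.mk w
  have hww' : w =ᵐ[volume.restrict Ω] w' := hw.1.ae_eq_mk
  have hw'm : Measurable w' := hw.1.stronglyMeasurable_mk.measurable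
  have hw' : MemLp w' 2 (volume.restrict Ω) := hw.ae_eq hww'
  have h0' : ∫ x in Ω, w' x = 0 := by rw [← integral_congr_ae hww', h0]
  have hsq : ∫ x in Ω, w x ^ 2 = ∫ x in Ω, w' x ^ 2 :=
    integral_congr_ae (hww'.mono fun x hx => by simp only [hx])
  rw [hsq, setIntegral_setIntegral_congr (fun x y s t => J (x - y) * (t - s) ^ 2)
    (ae_restrict_of_ae_restrict_of_subset (hA n) hww')
    (ae_restrict_of_ae_restrict_of_subset (hB n) hww')]
  have key := hn w' hw'm
  simp only [couplingEnergy] at key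
  rw [← ofReal_integral_sub_sq hw' hw'm h0',
    ← hJ.ofReal_integral_mul_sq (hw'.mono_measure (Measure.restrict_mono_set _ (hB n)))
      (hw'.mono_measure (Measure.restrict_mono_set _ (hA n))) hw'm,
    ← ENNReal.ofReal_toReal hC, ← ENNReal.ofReal_mul ENNReal.toReal_nonneg] at key
  have hE : 0 ≤ ∫ x in A n, ∫ y in B n, J (x - y) * (w' y - w' x) ^ 2 :=
    integral_nonneg fun x => integral_nonneg fun y => mul_nonneg (hJ.nonneg _) (sq_nonneg _)
  rw [ENNReal.ofReal_le_ofReal_iff (by positivity), measureReal_restrict_apply_univ] at key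
  rw [div_mul_eq_mul_div, le_div_iff₀ (by positivity)]
  nlinarith

end Kernel

/-! ### Sobolev functions with locally constant perturbations -/

section Sobolev

variable {N : ℕ} {U : Set (Space N)}

lemma integrable_mul_test {μ : Measure (Space N)} {u h : Space N → ℝ} (hu : Integrable u μ)
    (hh : Continuous h) (hc : HasCompactSupport h) : Integrable (fun x => u x * h x) μ := by
  obtain ⟨M, hM⟩ := hh.bounded_above_of_compact_support hc
  exact hu.mul_bdd (c := M) hh.measurable.aestronglyMeasurable (ae_of_all _ hM)

lemma continuous_partialDeriv {η : Space N → ℝ} (hη : ContDiff ℝ ∞ η) (v : Space N) :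
    Continuous fun x => fderiv ℝ η x v :=
  (hη.continuous_fderiv (by simp)).clm_apply continuous_const

lemma hasCompactSupport_partialDeriv {η : Space N → ℝ} (hη : HasCompactSupport η) (v : Space N) :
    HasCompactSupport fun x => fderiv ℝ η x v :=
  hη.fderiv_apply (𝕜 := ℝ) v

/-- Locally constant square integrable functions have zero weak gradient. -/
lemma isH1_of_locallyConstant {w : Space N → ℝ}
    (hw : MemLp w 2 (volume.restrict U)) [IsFiniteMeasure (volume.restrict U)]
    (hconst : ∀ x ∈ U, ∀ᶠ y in 𝓝 x, w y = w x) : IsH1 U w 0 where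
  memLp := hw
  memLp_grad := MemLp.zero
  weak_grad := by
    intro η hη hηc hηU i
    set e : Space N := EuclideanSpace.single i 1
    have hη1 : Differentiable ℝ η := hη.differentiable (by simp)
    -- The product is differentiable on the whole space, although `w` is arbitrary outside `U`: near
    -- the support of `η` the factor `w` is locally constant, and away from it the product vanishes.
    have hderiv : ∀ x, HasFDerivAt (fun y => w y * η y) (w x • fderiv ℝ η x) x := by
      intro x
      by_cases hx : x ∈ tsupport η
      · refine ((hη1 x).hasFDerivAt.const_mul (w x)).congr_of_eventuallyEq ?_
        filter_upwards [hconst x (hηU hx)] with y hy using by rw [hy]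
      · have h0 : η =ᶠ[𝓝 x] 0 := notMem_tsupport_iff_eventuallyEq.1 hx
        have hf0 : fderiv ℝ η x = 0 := by rw [h0.fderiv_eq]; simp
        rw [hf0, smul_zero]
        refine (hasFDerivAt_const (0 : ℝ) x).congr_of_eventuallyEq ?_
        filter_upwards [h0] with y hy using by simp [hy]
    have hw1 := hw.integrable one_le_two
    have hzero : ∀ h : Space N → ℝ, (∀ x, x ∉ tsupport η → h x = 0) →
        ∀ x, x ∉ U → w x * h x = 0 := fun h hh x hx => by rw [hh x fun h' => hx (hηU h'), mul_zero]
    have hη0 : ∀ x, x ∉ tsupport η → η x = 0 := fun x hx => image_eq_zero_of_notMem_tsupport hx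
    have hη0' : ∀ x, x ∉ tsupport η → fderiv ℝ η x e = 0 := fun x hx => by
      rw [(notMem_tsupport_iff_eventuallyEq.1 hx).fderiv_eq]; simp
    have hi1 : Integrable fun x => w x * η x :=
      (integrableOn_iff_integrable_of_support_subset
        (Function.support_subset_iff'.2 (hzero η hη0))).1
        (integrable_mul_test hw1 hη.continuous hηc)
    have hi2 : Integrable fun x => w x * fderiv ℝ η x e :=
      (integrableOn_iff_integrable_of_support_subset
        (Function.support_subset_iff'.2 (hzero _ hη0'))).1
        (integrable_mul_test hw1 (continuous_partialDeriv hη e)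
          (hasCompactSupport_partialDeriv hηc e))
    have hfd : ∀ x, fderiv ℝ (fun y => w y * η y) x e = w x * fderiv ℝ η x e := fun x => by
      rw [(hderiv x).fderiv]; simp
    -- Integration by parts against the constant `1`: the integral of a derivative of `w * η` is
    -- zero.
    have key := integral_mul_fderiv_eq_neg_fderiv_mul_of_integrable (μ := volume)
      (f := fun _ : Space N => (1 : ℝ)) (g := fun y => w y * η y) (v := e)
      (by simp) (by simpa [hfd] using hi2) (by simpa using hi1)
      (fun x _ => differentiableAt_const _) fun x _ => (hderiv x).differentiableAt
    simp only [hfd, one_mul, fderiv_fun_const, Pi.zero_apply, _root_.zero_apply,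
      zero_mul, integral_zero, neg_zero] at key
    rw [setIntegral_eq_integral_of_forall_compl_eq_zero fun x hx => hzero _ hη0' x hx, key]
    simp

lemma IsH1.sub [IsFiniteMeasure (volume.restrict U)] {u w : Space N → ℝ}
    {gu gw : Space N → Space N} (hu : IsH1 U u gu) (hw : IsH1 U w gw) :
    IsH1 U (fun x => u x - w x) (fun x => gu x - gw x) where
  memLp := hu.memLp.sub hw.memLp
  memLp_grad := hu.memLp_grad.sub hw.memLp_grad
  weak_grad := by
    intro η hη hηc hηU i
    have hd := continuous_partialDeriv hη (EuclideanSpace.single i 1)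
    have hdc := hasCompactSupport_partialDeriv hηc (EuclideanSpace.single i 1)
    have hcoord : ∀ g : Space N → Space N, MemLp g 2 (volume.restrict U) →
        Integrable (fun x => g x i) (volume.restrict U) := fun g hg =>
      (EuclideanSpace.proj i : Space N →L[ℝ] ℝ).integrable_comp (hg.integrable one_le_two)
    simp only [sub_mul, PiLp.sub_apply]
    rw [integral_sub (integrable_mul_test (hu.memLp.integrable one_le_two) hd hdc)
        (integrable_mul_test (hw.memLp.integrable one_le_two) hd hdc),
      integral_sub (integrable_mul_test (hcoord gu hu.memLp_grad) hη.continuous hηc)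
        (integrable_mul_test (hcoord gw hw.memLp_grad) hη.continuous hηc),
      hu.weak_grad η hη hηc hηU i, hw.weak_grad η hη hηc hηU i]
    ring

end Sobolev

/-! ### The energy inequality -/

section Energy

variable {N : ℕ} {J G : Space N → ℝ} {A B : Set (Space N)}

/-- The residual of `(w₁, w₂)` in the equation on the local region. -/
noncomputable def residual₁ (J : Space N → ℝ) (B : Set (Space N)) (f w₁ w₂ : Space N → ℝ)
    (x : Space N) : ℝ :=
  - f x + ∫ y in B, J (x - y) * (w₂ y - w₁ x)

/-- The residual of `(w₁, w₂)` in the equation on the nonlocal region. -/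
noncomputable def residual₂ (J G : Space N → ℝ) (A B : Set (Space N)) (f w₁ w₂ : Space N → ℝ)
    (x : Space N) : ℝ :=
  - f x + (∫ y in B, G (x - y) * (w₂ y - w₂ x)) + ∫ y in A, J (x - y) * (w₁ y - w₂ x)

/-- The equation is tested with the error. Writing the solution as error plus comparison pair splits
the nonlocal forms: the part quadratic in the error is the energy, and the part with the comparison
pair becomes the residuals by Fubini. The gradient term and the quadratic `G` term are nonnegative
and are dropped. -/
theorem couplingEnergy_le_residual (hJ : IsKernel J) (hG : IsKernel G)
    [IsFiniteMeasure (volume.restrict A)] [IsFiniteMeasure (volume.restrict B)]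
    {f u v w₁ w₂ : Space N → ℝ}
    (hfA : MemLp f 2 (volume.restrict A)) (hfB : MemLp f 2 (volume.restrict B))
    (huv : IsWeakSolution J G A B f u v) (hw₁ : IsH1 A w₁ 0)
    (hw₂ : MemLp w₂ 2 (volume.restrict B))
    (hmean : (∫ x in A, (u x - w₁ x)) + (∫ x in B, (v x - w₂ x)) = 0) :
    ∫ x in A, ∫ y in B, J (x - y) * ((v y - w₂ y) - (u x - w₁ x)) ^ 2 ≤
      (∫ x in A, (u x - w₁ x) * residual₁ J B f w₁ w₂ x)
        + ∫ x in B, (v x - w₂ x) * residual₂ J G A B f w₁ w₂ x := by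
  obtain ⟨gu, hadm, hsol⟩ := huv
  set φ : Space N → ℝ := fun x => u x - w₁ x with hφdef
  set ψ : Space N → ℝ := fun x => v x - w₂ x with hψdef
  have hφH : IsH1 A φ gu := by simpa using hadm.isH1.sub hw₁
  have hφ : MemLp φ 2 (volume.restrict A) := hφH.memLp
  have hψ : MemLp ψ 2 (volume.restrict B) := hadm.memLp.sub hw₂
  have hw₁' := hw₁.memLp
  have hweak := hsol φ gu ψ ⟨hφH, hψ, hmean⟩
  unfold couplingForm at hweak
  have hgrad : 0 ≤ ∫ x in A, inner ℝ (gu x) (gu x) :=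
    integral_nonneg fun x => real_inner_self_nonneg
  have hGsplit := hG.integral_pairing_add hψ hψ hw₂ hw₂ hψ hψ
  have hJsplit := hJ.integral_pairing_add hψ hφ hw₂ hw₁' hφ hψ
  -- Here both measures coincide, so the two terms produced by Fubini are equal and cancel the
  -- factor `1 / 2` of the form.
  have hGpair := hG.integral_pairing hw₂ hw₂ hψ hψ
  have hJpair := hJ.integral_pairing hw₂ hw₁' hφ hψ
  have hv : ∀ x, ψ x + w₂ x = v x := fun x => by simp [hψdef]
  have hu : ∀ x, φ x + w₁ x = u x := fun x => by simp [hφdef]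
  simp only [hv, hu] at hGsplit hJsplit
  rw [hGsplit, hJsplit, hGpair, hJpair] at hweak
  have hGpos : 0 ≤ ∫ x in B, ∫ y in B, G (x - y) * (ψ y - ψ x) * (ψ y - ψ x) :=
    integral_nonneg fun x => integral_nonneg fun y => by
      simp only [mul_assoc]
      exact mul_nonneg (hG.nonneg _) (mul_self_nonneg _)
  have hJsq : ∫ x in A, ∫ y in B, J (x - y) * (ψ y - φ x) ^ 2
      = ∫ x in A, ∫ y in B, J (x - y) * (ψ y - φ x) * (ψ y - φ x) := by
    simp only [pow_two, mul_assoc]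
  have hfφ : Integrable (fun x => - (f x * φ x)) (volume.restrict A) := (hfA.integrable_mul hφ).neg
  have e1 : ∫ x in A, φ x * residual₁ J B f w₁ w₂ x
      = - (∫ x in A, f x * φ x) + ∫ x in A, φ x * ∫ y in B, J (x - y) * (w₂ y - w₁ x) := by
    rw [← integral_neg, ← integral_add hfφ
      (hJ.integrable_mul_integral hw₂ hw₁' hφ)]
    exact integral_congr_ae (ae_of_all _ fun x => by simp only [residual₁]; ring)
  have hfψ : Integrable (fun x => - (f x * ψ x)) (volume.restrict B) := (hfB.integrable_mul hψ).neg
  have hGi := hG.integrable_mul_integral hw₂ hw₂ hψ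
  have hfGψ : Integrable
      (fun x => - (f x * ψ x) + ψ x * ∫ y in B, G (x - y) * (w₂ y - w₂ x)) (volume.restrict B) :=
    hfψ.add hGi
  have e2 : ∫ x in B, ψ x * residual₂ J G A B f w₁ w₂ x
      = - (∫ x in B, f x * ψ x) + (∫ x in B, ψ x * ∫ y in B, G (x - y) * (w₂ y - w₂ x))
        + ∫ x in B, ψ x * ∫ y in A, J (x - y) * (w₁ y - w₂ x) := by
    rw [← integral_neg, ← integral_add hfψ hGi, ← integral_add hfGψ
      (hJ.integrable_mul_integral hw₁' hw₂ hψ)]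
    exact integral_congr_ae (ae_of_all _ fun x => by
      simp only [residual₂]; ring)
  rw [e1, e2, hJsq]
  linarith

end Energy

/-! ### Sequences that tend to zero in varying `L²` spaces -/

section TendstoZero

variable {α : Type*} [MeasurableSpace α] {μ ν : ℕ → Measure α} {g h : ℕ → α → ℝ}

lemma eLpNorm_two_eq_ofReal_sqrt {μ : Measure α} {h : α → ℝ} (hh : MemLp h 2 μ) :
    eLpNorm h 2 μ = ENNReal.ofReal (Real.sqrt (∫ x, h x ^ 2 ∂μ)) := by
  rw [hh.eLpNorm_eq_integral_rpow_norm two_ne_zero ENNReal.ofNat_ne_top, Real.sqrt_eq_rpow]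
  simp

/-- `h n` is eventually square integrable for `μ n`, and its norm in `L²(μ n)` tends to zero. -/
structure TendstoZeroL2 (μ : ℕ → Measure α) (h : ℕ → α → ℝ) : Prop where
  memLp : ∀ᶠ n in atTop, MemLp (h n) 2 (μ n)
  tendsto : Tendsto (fun n => eLpNorm (h n) 2 (μ n)) atTop (𝓝 0)

lemma tendstoZeroL2_of_integral_sq (hm : ∀ᶠ n in atTop, MemLp (h n) 2 (μ n))
    (hlim : Tendsto (fun n => ∫ x, h n x ^ 2 ∂(μ n)) atTop (𝓝 0)) : TendstoZeroL2 μ h := by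
  refine ⟨hm, ?_⟩
  have h1 := ENNReal.tendsto_ofReal ((Real.continuous_sqrt.tendsto 0).comp hlim)
  rw [Real.sqrt_zero, ENNReal.ofReal_zero] at h1
  refine h1.congr' ?_
  filter_upwards [hm] with n hn
  exact (eLpNorm_two_eq_ofReal_sqrt hn).symm

namespace TendstoZeroL2

lemma integral_sq (hh : TendstoZeroL2 μ h) :
    Tendsto (fun n => ∫ x, h n x ^ 2 ∂(μ n)) atTop (𝓝 0) := by
  have h1 := (ENNReal.tendsto_toReal ENNReal.zero_ne_top).comp hh.tendsto
  have h2 := h1.pow 2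
  rw [ENNReal.toReal_zero, zero_pow two_ne_zero] at h2
  refine h2.congr' ?_
  filter_upwards [hh.memLp] with n hn
  simp only [Function.comp_apply]
  rw [eLpNorm_two_eq_ofReal_sqrt hn, ENNReal.toReal_ofReal (Real.sqrt_nonneg _),
    Real.sq_sqrt (integral_nonneg fun x => sq_nonneg _)]

lemma add (hg : TendstoZeroL2 μ g) (hh : TendstoZeroL2 μ h) :
    TendstoZeroL2 μ fun n x => g n x + h n x := by
  refine ⟨by filter_upwards [hg.memLp, hh.memLp] with n h1 h2 using h1.add h2, ?_⟩
  have hsum := hg.tendsto.add hh.tendsto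
  rw [add_zero] at hsum
  refine tendsto_of_tendsto_of_tendsto_of_le_of_le' tendsto_const_nhds hsum
    (Eventually.of_forall fun n => zero_le) ?_
  filter_upwards [hg.memLp, hh.memLp] with n h1 h2
  exact eLpNorm_add_le h1.1 h2.1 one_le_two

lemma neg (hh : TendstoZeroL2 μ h) : TendstoZeroL2 μ fun n x => - h n x :=
  ⟨hh.memLp.mono fun _ hn => hn.neg,
    hh.tendsto.congr fun n => (eLpNorm_neg (h n) 2 (μ n)).symm⟩

lemma sub (hg : TendstoZeroL2 μ g) (hh : TendstoZeroL2 μ h) :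
    TendstoZeroL2 μ fun n x => g n x - h n x := by
  simpa only [sub_eq_add_neg] using hg.add hh.neg

lemma congr (hh : TendstoZeroL2 μ h) (hgh : ∀ᶠ n in atTop, g n =ᵐ[μ n] h n) :
    TendstoZeroL2 μ g := by
  refine ⟨?_, hh.tendsto.congr' ?_⟩
  · filter_upwards [hh.memLp, hgh] with n h1 h2 using h1.ae_eq h2.symm
  · filter_upwards [hgh] with n h2 using (eLpNorm_congr_ae h2).symm

lemma mono_measure (hh : TendstoZeroL2 ν h) (hμ : ∀ n, μ n ≤ ν n) : TendstoZeroL2 μ h :=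
  ⟨hh.memLp.mono fun n hn => hn.mono_measure (hμ n),
    tendsto_of_tendsto_of_tendsto_of_le_of_le tendsto_const_nhds hh.tendsto
      (fun _ => zero_le) fun n => eLpNorm_mono_measure _ (hμ n)⟩

end TendstoZeroL2

/-- Uniform convergence to zero on sets of bounded measure. -/
lemma tendstoZeroL2_of_uniform {m : Measure α} [IsFiniteMeasure m] (hμ : ∀ n, μ n ≤ m)
    (hm : ∀ᶠ n in atTop, AEStronglyMeasurable (h n) (μ n))
    (hlim : ∀ ε > 0, ∀ᶠ n in atTop, ∀ᵐ x ∂(μ n), |h n x| ≤ ε) : TendstoZeroL2 μ h := by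
  have hfin : ∀ n, IsFiniteMeasure (μ n) := fun n =>
    ⟨(hμ n Set.univ).trans_lt (measure_lt_top m Set.univ)⟩
  have hmem : ∀ᶠ n in atTop, MemLp (h n) 2 (μ n) := by
    filter_upwards [hm, hlim 1 one_pos] with n h1 h2 using MemLp.of_bound h1 1 h2
  refine tendstoZeroL2_of_integral_sq hmem ?_
  rw [Metric.tendsto_nhds]
  intro ε hε
  -- Chosen so that `δ²` times the total mass is at most `ε / 2`; the added `1` covers the case of
  -- mass zero.
  set δ := Real.sqrt (ε / (2 * (m.real Set.univ + 1)))
  have hδ : 0 < δ := Real.sqrt_pos.2 (by positivity)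
  filter_upwards [hmem, hlim δ hδ] with n h1 h2
  rw [Real.dist_0_eq_abs, abs_of_nonneg (integral_nonneg fun x => sq_nonneg _)]
  calc ∫ x, h n x ^ 2 ∂(μ n) ≤ ∫ _, δ ^ 2 ∂(μ n) := by
        refine integral_mono_ae h1.integrable_sq (integrable_const _) ?_
        filter_upwards [h2] with x hx
        exact sq_le_sq' (abs_le.1 hx).1 (abs_le.1 hx).2
    _ = (μ n).real Set.univ * (ε / (2 * (m.real Set.univ + 1))) := by
        rw [integral_const, smul_eq_mul, Real.sq_sqrt (by positivity)]
    _ ≤ (m.real Set.univ + 1) * (ε / (2 * (m.real Set.univ + 1))) := by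
        gcongr
        have : (μ n).real Set.univ ≤ m.real Set.univ :=
          ENNReal.toReal_mono (measure_ne_top m _) (hμ n _)
        linarith
    _ = ε / 2 := by field_simp
    _ < ε := half_lt_self hε

/-- A bounded sequence that tends to zero pointwise, multiplied by a fixed `L²` function. -/
lemma tendstoZeroL2_mul {m : Measure α} {k : α → ℝ} (hk : MemLp k 2 m) {C : ℝ}
    (hm : ∀ᶠ n in atTop, AEStronglyMeasurable (h n) m)
    (hC : ∀ᶠ n in atTop, ∀ x, |h n x| ≤ C)
    (hlim : ∀ x, Tendsto (fun n => h n x) atTop (𝓝 0)) :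
    TendstoZeroL2 (fun _ => m) fun n x => k x * h n x := by
  have hmem : ∀ᶠ n in atTop, MemLp (fun x => k x * h n x) 2 m := by
    filter_upwards [hm, hC] with n h1 h2
    refine (hk.mul_const C).mono (hk.1.mul h1) (ae_of_all _ fun x => ?_)
    rw [norm_mul, norm_mul]
    refine mul_le_mul_of_nonneg_left ?_ (norm_nonneg _)
    exact (h2 x).trans (le_abs_self C)
  refine tendstoZeroL2_of_integral_sq hmem ?_
  rw [← integral_zero α ℝ (μ := m)]
  refine tendsto_integral_filter_of_dominated_convergence (fun x => (k x * C) ^ 2)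
    (hmem.mono fun n hn => hn.1.pow 2) ?_ (hk.mul_const C).integrable_sq (ae_of_all _ fun x => ?_)
  · filter_upwards [hC] with n h2
    refine ae_of_all _ fun x => ?_
    rw [norm_pow, Real.norm_eq_abs, ← sq_abs (k x * C)]
    refine pow_le_pow_left₀ (abs_nonneg _) ?_ 2
    rw [abs_mul, abs_mul]
    exact mul_le_mul_of_nonneg_left ((h2 x).trans (le_abs_self C)) (abs_nonneg _)
  · have := ((hlim x).const_mul (k x)).pow 2
    simpa using this

end TendstoZero

/-! ### Convergence of the residuals -/

section Residual

variable {N : ℕ} {K : Space N → ℝ} {Ω : Set (Space N)}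

lemma IsKernel.aestronglyMeasurable_integral (hK : IsKernel K) {μ ν : Measure (Space N)}
    [IsFiniteMeasure μ] [IsFiniteMeasure ν] {h : Space N → ℝ} (hh : Integrable h ν) :
    AEStronglyMeasurable (fun x => ∫ y, K (x - y) * h y ∂ν) μ :=
  (hK.integrable_mul (hh.comp_snd μ)).integral_prod_left.aestronglyMeasurable

lemma IsKernel.abs_integral_le (hK : IsKernel K) {M : ℝ} (hM : ∀ z, |K z| ≤ M)
    {ν : Measure (Space N)} {h : Space N → ℝ} (hh : Integrable h ν) (x : Space N) :
    |∫ y, K (x - y) * h y ∂ν| ≤ M * ∫ y, |h y| ∂ν := by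
  rw [← integral_const_mul]
  refine abs_integral_le_integral_abs.trans
    (integral_mono (hK.integrable_mul_right x hh).abs (hh.abs.const_mul M) fun y => ?_)
  simp only [abs_mul]
  exact mul_le_mul_of_nonneg_right (hM _) (abs_nonneg _)

/-- Weak-* convergence of the characteristic functions of `S n`, tested with a kernel. -/
lemma IsKernel.tendstoZeroL2_mul_integral (hK : IsKernel K) (hΩ : volume Ω ≠ ⊤)
    {S : ℕ → Set (Space N)} (hSm : ∀ᶠ n in atTop, MeasurableSet (S n)) (hS : ∀ n, S n ⊆ Ω)
    {s : ℝ} (hstar : TendstoWeakStar Ω (fun n => (S n).indicator fun _ => 1) fun _ => s)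
    {k h : Space N → ℝ} (hk : MemLp k 2 (volume.restrict Ω)) (hh : IntegrableOn h Ω) :
    TendstoZeroL2 (fun _ => volume.restrict Ω) fun n x =>
      k x * ((∫ y in S n, K (x - y) * h y) - s * ∫ y in Ω, K (x - y) * h y) := by
  obtain ⟨M, hM0, hM⟩ := hK.exists_bound
  have hfΩ : IsFiniteMeasure (volume.restrict Ω) := isFiniteMeasure_restrict.2 hΩ
  have hfS : ∀ n, IsFiniteMeasure (volume.restrict (S n)) := fun n =>
    isFiniteMeasure_restrict.2 (measure_ne_top_of_subset (hS n) hΩ)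
  have hhS : ∀ n, IntegrableOn h (S n) := fun n => hh.mono_set (hS n)
  refine tendstoZeroL2_mul hk (C := M * (∫ y in Ω, |h y|) + |s| * (M * ∫ y in Ω, |h y|)) ?_ ?_ ?_
  · exact Eventually.of_forall fun n => (hK.aestronglyMeasurable_integral (hhS n)).sub
      ((hK.aestronglyMeasurable_integral hh).const_mul s)
  · refine Eventually.of_forall fun n x => (abs_sub _ _).trans (add_le_add ?_ ?_)
    · refine (hK.abs_integral_le hM (hhS n) x).trans (mul_le_mul_of_nonneg_left ?_ hM0)
      exact setIntegral_mono_set hh.abs (ae_of_all _ fun _ => abs_nonneg _)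
        (ae_of_all _ (hS n))
    · rw [abs_mul]
      exact mul_le_mul_of_nonneg_left (hK.abs_integral_le hM hh x) (abs_nonneg _)
  -- For fixed `x`, the function `y ↦ K (x - y) * h y` is an admissible weak-* test function. This
  -- gives pointwise convergence, and the bounds above are uniform in `x`.
  · intro x
    have hlim := (hstar _ (hK.integrable_mul_right x hh)).sub_const
      (∫ y in Ω, s * (K (x - y) * h y))
    rw [sub_self, integral_const_mul] at hlim
    refine hlim.congr' ?_
    filter_upwards [hSm] with n hn
    congr 1
    rw [← Set.inter_eq_self_of_subset_right (hS n), ← setIntegral_indicator hn]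
    refine integral_congr_ae (ae_of_all _ fun y => ?_)
    by_cases hy : y ∈ S n <;> simp [hy, Set.inter_eq_self_of_subset_right (hS n)]

variable {J G : Space N → ℝ} {A B : ℕ → Set (Space N)} {a b : ℝ} {f : ℕ → Space N → ℝ}
  {f' U V : Space N → ℝ} {w : ℕ → Space N → ℝ}

lemma setIntegral_kernel_mul_sub_const (hK : IsKernel K) {ν : Measure (Space N)}
    [IsFiniteMeasure ν] {h : Space N → ℝ} (hh : Integrable h ν) (x : Space N) (c : ℝ) :
    ∫ y, K (x - y) * (h y - c) ∂ν = (∫ y, K (x - y) * h y ∂ν) - c * ∫ y, K (x - y) * 1 ∂ν := by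
  rw [← integral_const_mul, ← integral_sub (hK.integrable_mul_right x hh)
    ((hK.integrable_mul_right x (integrable_const (1 : ℝ))).const_mul c)]
  exact integral_congr_ae (ae_of_all _ fun y => by simp only; ring)

/-- Inserting the homogenized equation for `f'`, the residual is a sum of vanishing terms: `t1` and
`t2` replace integration over `B n` by `b` times integration over `Ω`, `hf` accounts for the
sources, and `t3` for the distance from `w n` to `U`. -/
theorem tendstoZeroL2_residual₁ (hJ : IsKernel J) (hΩ : volume Ω ≠ ⊤)
    (hAm : ∀ᶠ n in atTop, MeasurableSet (A n)) (hBm : ∀ᶠ n in atTop, MeasurableSet (B n))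
    (hA : ∀ n, A n ⊆ Ω) (hB : ∀ n, B n ⊆ Ω)
    (hBstar : TendstoWeakStar Ω (fun n => (B n).indicator fun _ => 1) fun _ => b)
    (hf : TendstoZeroL2 (fun _ => volume.restrict Ω) fun n x => f n x - f' x)
    (hU : MemLp U 2 (volume.restrict Ω)) (hV : MemLp V 2 (volume.restrict Ω))
    (hw : ∀ ε > 0, ∀ᶠ n in atTop, ∀ x ∈ A n, |w n x - U x| ≤ ε)
    (hwm : ∀ᶠ n in atTop, AEStronglyMeasurable (w n) (volume.restrict (A n)))
    (heq : ∀ᵐ x ∂(volume.restrict Ω), f' x = b * ∫ y in Ω, J (x - y) * (V y - U x)) :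
    TendstoZeroL2 (fun n => volume.restrict (A n)) fun n => residual₁ J (B n) (f n) (w n) V := by
  obtain ⟨M, hM0, hM⟩ := hJ.exists_bound
  have hfΩ : IsFiniteMeasure (volume.restrict Ω) := isFiniteMeasure_restrict.2 hΩ
  have hfA : ∀ n, IsFiniteMeasure (volume.restrict (A n)) := fun n =>
    isFiniteMeasure_restrict.2 (measure_ne_top_of_subset (hA n) hΩ)
  have hfB : ∀ n, IsFiniteMeasure (volume.restrict (B n)) := fun n =>
    isFiniteMeasure_restrict.2 (measure_ne_top_of_subset (hB n) hΩ)
  have hle : ∀ n, volume.restrict (A n) ≤ volume.restrict Ω := fun n =>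
    Measure.restrict_mono_set _ (hA n)
  have hV1 := hV.integrable one_le_two
  have t1 := hJ.tendstoZeroL2_mul_integral hΩ hBm hB hBstar (memLp_const (1 : ℝ)) hV1
  have t2 := hJ.tendstoZeroL2_mul_integral hΩ hBm hB hBstar hU (integrable_const (1 : ℝ))
  have t3 : TendstoZeroL2 (fun n => volume.restrict (A n)) fun n x =>
      (w n x - U x) * ∫ y in B n, J (x - y) * 1 := by
    refine tendstoZeroL2_of_uniform (m := volume.restrict Ω) hle ?_ fun ε hε => ?_
    · filter_upwards [hwm] with n hn
      exact (hn.sub (hU.1.mono_measure (hle n))).mul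
        (hJ.aestronglyMeasurable_integral (integrable_const (1 : ℝ)))
    · have hD : 0 < M * volume.real Ω + 1 := by positivity
      filter_upwards [hw (ε / (M * volume.real Ω + 1)) (by positivity), hAm] with n hn hnm
      filter_upwards [ae_restrict_mem hnm] with x hx
      rw [abs_mul]
      have hq : |∫ y in B n, J (x - y) * 1| ≤ M * volume.real Ω + 1 := by
        refine (hJ.abs_integral_le hM (integrable_const (1 : ℝ)) x).trans ?_
        have : volume.real (B n) ≤ volume.real Ω := measureReal_mono (hB n) hΩ
        simp only [abs_one, integral_const, smul_eq_mul, mul_one, measureReal_restrict_apply_univ]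
        nlinarith
      calc |w n x - U x| * |∫ y in B n, J (x - y) * 1|
          ≤ ε / (M * volume.real Ω + 1) * (M * volume.real Ω + 1) := by
            gcongr
            exact hn x hx
        _ = ε := by field_simp
  refine ((((t1.sub t2).sub hf).mono_measure hle).sub t3).congr (Eventually.of_forall fun n => ?_)
  filter_upwards [ae_restrict_of_ae_restrict_of_subset (hA n) heq] with x hx
  have hV1B : IntegrableOn V (B n) := IntegrableOn.mono_set hV1 (hB n)
  rw [setIntegral_kernel_mul_sub_const hJ hV1] at hx
  rw [residual₁, setIntegral_kernel_mul_sub_const hJ hV1B, hx]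
  ring

/-- The same decomposition, with weak-* limits of both phases. The corrector now stands under the
integral (`t5`), where its uniform closeness to `U` and the bounded kernel give a bound uniform in
`x`. -/
theorem tendstoZeroL2_residual₂ (hJ : IsKernel J) (hG : IsKernel G) (hΩ : volume Ω ≠ ⊤)
    (hAm : ∀ᶠ n in atTop, MeasurableSet (A n)) (hBm : ∀ᶠ n in atTop, MeasurableSet (B n))
    (hA : ∀ n, A n ⊆ Ω) (hB : ∀ n, B n ⊆ Ω)
    (hAstar : TendstoWeakStar Ω (fun n => (A n).indicator fun _ => 1) fun _ => a)
    (hBstar : TendstoWeakStar Ω (fun n => (B n).indicator fun _ => 1) fun _ => b)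
    (hf : TendstoZeroL2 (fun _ => volume.restrict Ω) fun n x => f n x - f' x)
    (hU : MemLp U 2 (volume.restrict Ω)) (hV : MemLp V 2 (volume.restrict Ω))
    (hw : ∀ ε > 0, ∀ᶠ n in atTop, ∀ x ∈ A n, |w n x - U x| ≤ ε)
    (hwm : ∀ᶠ n in atTop, MemLp (w n) 2 (volume.restrict (A n)))
    (heq : ∀ᵐ x ∂(volume.restrict Ω), f' x = b * (∫ y in Ω, G (x - y) * (V y - V x))
      + a * ∫ y in Ω, J (x - y) * (U y - V x)) :
    TendstoZeroL2 (fun n => volume.restrict (B n)) fun n =>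
      residual₂ J G (A n) (B n) (f n) (w n) V := by
  obtain ⟨M, hM0, hM⟩ := hJ.exists_bound
  have hfΩ : IsFiniteMeasure (volume.restrict Ω) := isFiniteMeasure_restrict.2 hΩ
  have hfA : ∀ n, IsFiniteMeasure (volume.restrict (A n)) := fun n =>
    isFiniteMeasure_restrict.2 (measure_ne_top_of_subset (hA n) hΩ)
  have hfB : ∀ n, IsFiniteMeasure (volume.restrict (B n)) := fun n =>
    isFiniteMeasure_restrict.2 (measure_ne_top_of_subset (hB n) hΩ)
  have hle : ∀ n, volume.restrict (B n) ≤ volume.restrict Ω := fun n =>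
    Measure.restrict_mono_set _ (hB n)
  have hV1 := hV.integrable one_le_two
  have hU1 := hU.integrable one_le_two
  have hU1A : ∀ n, IntegrableOn U (A n) := fun n => IntegrableOn.mono_set hU1 (hA n)
  have t1 := hG.tendstoZeroL2_mul_integral hΩ hBm hB hBstar (memLp_const (1 : ℝ)) hV1
  have t2 := hG.tendstoZeroL2_mul_integral hΩ hBm hB hBstar hV (integrable_const (1 : ℝ))
  have t3 := hJ.tendstoZeroL2_mul_integral hΩ hAm hA hAstar (memLp_const (1 : ℝ)) hU1
  have t4 := hJ.tendstoZeroL2_mul_integral hΩ hAm hA hAstar hV (integrable_const (1 : ℝ))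
  have t5 : TendstoZeroL2 (fun n => volume.restrict (B n)) fun n x =>
      ∫ y in A n, J (x - y) * (w n y - U y) := by
    have hdiff : ∀ n, MemLp (w n) 2 (volume.restrict (A n)) →
        IntegrableOn (fun y => w n y - U y) (A n) := fun n hn =>
      (hn.integrable one_le_two).sub (hU1A n)
    refine tendstoZeroL2_of_uniform (m := volume.restrict Ω) hle ?_ fun ε hε => ?_
    · filter_upwards [hwm] with n hn
      exact hJ.aestronglyMeasurable_integral (hdiff n hn)
    · have hD : 0 < M * volume.real Ω + 1 := by positivity
      filter_upwards [hw (ε / (M * volume.real Ω + 1)) (by positivity), hAm, hwm] with n hn hnm hwn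
      refine ae_of_all _ fun x => (hJ.abs_integral_le hM (hdiff n hwn) x).trans ?_
      have h1 : ∫ y in A n, |w n y - U y| ≤ volume.real Ω * (ε / (M * volume.real Ω + 1)) := by
        calc ∫ y in A n, |w n y - U y| ≤ ∫ _ in A n, ε / (M * volume.real Ω + 1) := by
              refine setIntegral_mono_on (hdiff n hwn).abs (integrable_const _) hnm hn
          _ = volume.real (A n) * (ε / (M * volume.real Ω + 1)) := by simp
          _ ≤ _ := by
              gcongr
              exact hA n
      calc M * ∫ y in A n, |w n y - U y|
          ≤ M * (volume.real Ω * (ε / (M * volume.real Ω + 1))) := by gcongr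
        _ = (M * volume.real Ω) * (ε / (M * volume.real Ω + 1)) := by ring
        _ ≤ (M * volume.real Ω + 1) * (ε / (M * volume.real Ω + 1)) := by
            gcongr
            linarith
        _ = ε := by field_simp
  refine (((((t1.sub t2).add (t3.sub t4)).sub hf).mono_measure hle).add t5).congr ?_
  filter_upwards [hwm] with n hwn
  filter_upwards [ae_restrict_of_ae_restrict_of_subset (hB n) heq] with x hx
  have hV1B : IntegrableOn V (B n) := IntegrableOn.mono_set hV1 (hB n)
  have hw1 := hwn.integrable one_le_two
  rw [setIntegral_kernel_mul_sub_const hG hV1, setIntegral_kernel_mul_sub_const hJ hU1] at hx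
  have hsub : ∫ y in A n, J (x - y) * (w n y - U y)
      = (∫ y in A n, J (x - y) * w n y) - ∫ y in A n, J (x - y) * U y := by
    rw [← integral_sub (hJ.integrable_mul_right x hw1) (hJ.integrable_mul_right x (hU1A n))]
    simp only [mul_sub]
  rw [residual₂, setIntegral_kernel_mul_sub_const hG hV1B, setIntegral_kernel_mul_sub_const hJ hw1,
    hx, hsub]
  ring

end Residual

/-! ### The correctors -/

section Corrector

variable {N : ℕ} {Ω T : Set (Space N)} {ℓ : Fin N → ℝ} {n : ℕ} {X : ℝ} {u : Space N → ℝ}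

/-- Holes with different indices lie in different cells, so only one term of the sum survives. -/
lemma corrector₁_of_mem (hℓ : ∀ i, 0 < ℓ i) (hn : 1 ≤ n) (hT : T ⊆ cell ℓ) {k : Fin N → ℤ}
    (hk : k ∈ holeIndex Ω ℓ T n) {x : Space N} (hx : x ∈ scaledCopy ℓ n k T) :
    corrector₁ Ω ℓ T X u n x = ⨍ z in scaledCopy ℓ n k T, u z / X := by
  classical
  have hxA : x ∈ localRegion Ω ℓ T n := mem_localRegion_iff.2 ⟨k, hk, hx⟩
  rw [corrector₁, if_pos hxA, finsum_eq_single _ k]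
  · rw [finsum_eq_if, if_pos hk, Set.indicator_of_mem hx]
  · intro j hj
    have hxj : x ∉ scaledCopy ℓ n j T := fun h =>
      hj ((cellIndex_of_mem hℓ hn hT h).symm.trans (cellIndex_of_mem hℓ hn hT hx))
    rw [finsum_eq_if, Set.indicator_of_notMem hxj, ite_self]

/-- Each hole is an open neighbourhood of its points. This local constancy is what makes the weak
gradient of the corrector vanish. -/
lemma corrector₁_eventuallyEq (hℓ : ∀ i, 0 < ℓ i) (hn : 1 ≤ n) (hTo : IsOpen T)
    (hT : T ⊆ cell ℓ) {x : Space N} (hx : x ∈ localRegion Ω ℓ T n) :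
    ∀ᶠ y in 𝓝 x, corrector₁ Ω ℓ T X u n y = corrector₁ Ω ℓ T X u n x := by
  obtain ⟨k, hk, hxk⟩ := mem_localRegion_iff.1 hx
  filter_upwards [(isOpen_scaledCopy hn k hTo).mem_nhds hxk] with y hy
  rw [corrector₁_of_mem hℓ hn hT hk hxk, corrector₁_of_mem hℓ hn hT hk hy]

lemma aestronglyMeasurable_corrector₁ (hℓ : ∀ i, 0 < ℓ i) (hn : 1 ≤ n) (hTo : IsOpen T)
    (hT : T ⊆ cell ℓ) :
    AEStronglyMeasurable (corrector₁ Ω ℓ T X u n) (volume.restrict (localRegion Ω ℓ T n)) := by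
  refine ContinuousOn.aestronglyMeasurable (fun x hx => ContinuousAt.continuousWithinAt ?_)
    (isOpen_localRegion hn hTo).measurableSet
  exact tendsto_const_nhds.congr' ((corrector₁_eventuallyEq hℓ hn hTo hT hx).mono fun y hy => hy.symm)

/-- All values of `u / X` on the hole lie in a closed interval of radius `ε` around the value at
`x`; by convexity so does their average. -/
lemma abs_corrector₁_sub_le (hℓ : ∀ i, 0 < ℓ i) (hn : 1 ≤ n) (hTo : IsOpen T)
    (hT : T ⊆ cell ℓ) (hT0 : volume T ≠ 0) (hu : IntegrableOn (fun z => u z / X) Ω) {ε : ℝ}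
    (hosc : ∀ x ∈ Ω, ∀ y ∈ Ω, dist x y ≤ Metric.diam (halfOpenCell ℓ) / n →
      |u x / X - u y / X| ≤ ε)
    {x : Space N} (hx : x ∈ localRegion Ω ℓ T n) :
    |corrector₁ Ω ℓ T X u n x - u x / X| ≤ ε := by
  obtain ⟨k, hk, hxk⟩ := mem_localRegion_iff.1 hx
  have hsub : scaledCopy ℓ n k T ⊆ Ω := (scaledCopy_mono subset_closure).trans hk
  have hcell : scaledCopy ℓ n k T ⊆ scaledCopy ℓ n k (halfOpenCell ℓ) :=
    scaledCopy_mono (hT.trans cell_subset_halfOpenCell)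
  rw [corrector₁_of_mem hℓ hn hT hk hxk, ← Real.dist_eq, ← Metric.mem_closedBall]
  have hn0 : (0 : ℝ) < |(1 / (n : ℝ)) ^ N| := by positivity
  refine (convex_closedBall _ _).set_average_mem Metric.isClosed_closedBall ?_
    (volume_scaledCopy_ne_top (measure_ne_top_of_subset hT (volume_cell_ne_top ℓ)) k) ?_
    (hu.mono_set hsub)
  · rw [volume_scaledCopy]
    exact mul_ne_zero (ENNReal.ofReal_pos.2 hn0).ne' hT0
  · filter_upwards [ae_restrict_mem (isOpen_scaledCopy hn k hTo).measurableSet] with z hz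
    rw [Metric.mem_closedBall, Real.dist_eq]
    exact hosc z (hsub hz) x (hsub hxk) (dist_le_of_mem_scaledCopy (hcell hz) (hcell hxk))

lemma eventually_abs_corrector₁_sub_le (hℓ : ∀ i, 0 < ℓ i) (hTo : IsOpen T)
    (hT : T ⊆ cell ℓ) (hT0 : volume T ≠ 0) (hΩ : Bornology.IsBounded Ω)
    (hu : IntegrableOn (fun z => u z / X) Ω) (huc : ContinuousOn u (closure Ω)) {ε : ℝ}
    (hε : 0 < ε) :
    ∀ᶠ n in atTop, ∀ x ∈ localRegion Ω ℓ T n, |corrector₁ Ω ℓ T X u n x - u x / X| ≤ ε := by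
  obtain ⟨δ, hδ, h⟩ := Metric.uniformContinuousOn_iff.1
    (hΩ.isCompact_closure.uniformContinuousOn_of_continuous (huc.div_const X)) ε hε
  filter_upwards [(tendsto_diam_div ℓ).eventually (gt_mem_nhds hδ), eventually_ge_atTop 1]
    with n hnδ hn x hx
  refine abs_corrector₁_sub_le hℓ hn hTo hT hT0 hu (fun y hy z hz hyz => ?_) hx
  exact (h y (subset_closure hy) z (subset_closure hz) (hyz.trans_lt hnδ)).le

end Corrector

/-! ### Convergence of both phases -/

section Phases

variable {N : ℕ} {Ω : Set (Space N)} {A B : ℕ → Set (Space N)}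

lemma mul_le_young {C : ℝ} (hC : 0 < C) (s t : ℝ) :
    s * t ≤ (C / 2) * t ^ 2 + (1 / (2 * C)) * s ^ 2 := by
  have h : (C / 2) * t ^ 2 + (1 / (2 * C)) * s ^ 2 - s * t = (C * t - s) ^ 2 / (2 * C) := by
    field_simp
    ring
  have : 0 ≤ (C * t - s) ^ 2 / (2 * C) := by positivity
  linarith

lemma integral_mul_le_young {α : Type*} [MeasurableSpace α] {μ : Measure α} {φ r : α → ℝ}
    (hφ : MemLp φ 2 μ) (hr : MemLp r 2 μ) {C : ℝ} (hC : 0 < C) :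
    ∫ x, φ x * r x ∂μ ≤ (C / 2) * (∫ x, r x ^ 2 ∂μ) + (1 / (2 * C)) * ∫ x, φ x ^ 2 ∂μ := by
  rw [← integral_const_mul, ← integral_const_mul, ← integral_add (hr.integrable_sq.const_mul _)
    (hφ.integrable_sq.const_mul _)]
  exact integral_mono (hφ.integrable_mul hr)
    ((hr.integrable_sq.const_mul _).add (hφ.integrable_sq.const_mul _))
    fun x => mul_le_young hC _ _

/-- The two components are glued into one mean-zero function on `Ω`, to which coercivity applies,
and the pairing with the residuals is absorbed by Young's inequality. -/
lemma integral_sq_add_le_of_coercive {J : Space N → ℝ} {A B : Set (Space N)}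
    (hA : MeasurableSet A) (hB : MeasurableSet B) (hAB : A ∪ B = Ω) (hdisj : Disjoint A B)
    (hΩ : volume Ω ≠ ⊤) {C : ℝ} (hC : 0 < C)
    (hcoer : ∀ w : Space N → ℝ, MemLp w 2 (volume.restrict Ω) → ∫ x in Ω, w x = 0 →
      ∫ x in Ω, w x ^ 2 ≤ C * ∫ x in A, ∫ y in B, J (x - y) * (w y - w x) ^ 2)
    {φ ψ r₁ r₂ : Space N → ℝ} (hφ : MemLp φ 2 (volume.restrict A))
    (hψ : MemLp ψ 2 (volume.restrict B)) (hr₁ : MemLp r₁ 2 (volume.restrict A))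
    (hr₂ : MemLp r₂ 2 (volume.restrict B))
    (hmean : (∫ x in A, φ x) + (∫ x in B, ψ x) = 0)
    (henergy : ∫ x in A, ∫ y in B, J (x - y) * (ψ y - φ x) ^ 2
      ≤ (∫ x in A, φ x * r₁ x) + ∫ x in B, ψ x * r₂ x) :
    (∫ x in A, φ x ^ 2) + (∫ x in B, ψ x ^ 2)
      ≤ C ^ 2 * ((∫ x in A, r₁ x ^ 2) + ∫ x in B, r₂ x ^ 2) := by
  classical
  have hfΩ : IsFiniteMeasure (volume.restrict Ω) := isFiniteMeasure_restrict.2 hΩ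
  set w : Space N → ℝ := A.piecewise φ ψ
  have hwA : ∀ x ∈ A, w x = φ x := fun x hx => Set.piecewise_eq_of_mem _ _ _ hx
  have hwB : ∀ x ∈ B, w x = ψ x := fun x hx =>
    Set.piecewise_eq_of_notMem _ _ _ fun h => Set.disjoint_left.1 hdisj h hx
  have hAΩ : A ⊆ Ω := hAB ▸ Set.subset_union_left
  have hw : MemLp w 2 (volume.restrict Ω) := by
    refine MemLp.piecewise hA ?_ ?_
    · rwa [Measure.restrict_restrict hA, Set.inter_eq_self_of_subset_left hAΩ]
    · have : Aᶜ ∩ Ω = B := by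
        rw [← hAB, Set.inter_union_distrib_left, Set.compl_inter_self, Set.empty_union,
          Set.inter_eq_right]
        exact fun x hx h => Set.disjoint_left.1 hdisj h hx
      rwa [Measure.restrict_restrict hA.compl, this]
  have hsplit : ∀ F : ℝ → ℝ, IntegrableOn (fun x => F (w x)) Ω →
      ∫ x in Ω, F (w x) = (∫ x in A, F (φ x)) + ∫ x in B, F (ψ x) := by
    intro F hF
    rw [← hAB] at hF ⊢
    rw [setIntegral_union hdisj hB (hF.mono_set Set.subset_union_left)
      (hF.mono_set Set.subset_union_right),
      setIntegral_congr_fun hA fun x hx => congrArg F (hwA x hx),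
      setIntegral_congr_fun hB fun x hx => congrArg F (hwB x hx)]
  have h0 : ∫ x in Ω, w x = 0 := (hsplit id (hw.integrable one_le_two)).trans hmean
  have hsq := hsplit (fun t => t ^ 2) hw.integrable_sq
  have hE : ∫ x in A, ∫ y in B, J (x - y) * (w y - w x) ^ 2
      = ∫ x in A, ∫ y in B, J (x - y) * (ψ y - φ x) ^ 2 :=
    setIntegral_congr_fun hA fun x hx => setIntegral_congr_fun hB fun y hy => by
      simp only [hwA x hx, hwB y hy]
  have hmain := hcoer w hw h0
  rw [hsq, hE] at hmain
  have y1 := integral_mul_le_young hφ hr₁ hC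
  have y2 := integral_mul_le_young hψ hr₂ hC
  -- The Young weights are tuned to `C`: after multiplication by `C`, exactly half of the left-hand
  -- side appears on the right and is absorbed.
  have h3 := hmain.trans (mul_le_mul_of_nonneg_left (henergy.trans (add_le_add y1 y2)) hC.le)
  have h4 : C * (C / 2 * (∫ x in A, r₁ x ^ 2) + 1 / (2 * C) * (∫ x in A, φ x ^ 2)
      + (C / 2 * (∫ x in B, r₂ x ^ 2) + 1 / (2 * C) * ∫ x in B, ψ x ^ 2))
      = C ^ 2 / 2 * ((∫ x in A, r₁ x ^ 2) + ∫ x in B, r₂ x ^ 2)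
        + 1 / 2 * ((∫ x in A, φ x ^ 2) + ∫ x in B, ψ x ^ 2) := by
    field_simp
    ring
  rw [h4] at h3
  linarith

lemma TendstoZeroL2.of_integral_sq_add_le {α : Type*} [MeasurableSpace α] {μ ν : ℕ → Measure α}
    {φ ψ r₁ r₂ : ℕ → α → ℝ} {C : ℝ} (hr₁ : TendstoZeroL2 μ r₁) (hr₂ : TendstoZeroL2 ν r₂)
    (hφ : ∀ᶠ n in atTop, MemLp (φ n) 2 (μ n)) (hψ : ∀ᶠ n in atTop, MemLp (ψ n) 2 (ν n))
    (h : ∀ᶠ n in atTop, (∫ x, φ n x ^ 2 ∂(μ n)) + (∫ x, ψ n x ^ 2 ∂(ν n))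
      ≤ C * ((∫ x, r₁ n x ^ 2 ∂(μ n)) + ∫ x, r₂ n x ^ 2 ∂(ν n))) :
    TendstoZeroL2 μ φ ∧ TendstoZeroL2 ν ψ := by
  have hlim := (hr₁.integral_sq.add hr₂.integral_sq).const_mul C
  rw [add_zero, mul_zero] at hlim
  have p1 : ∀ n, 0 ≤ ∫ x, φ n x ^ 2 ∂(μ n) := fun n => integral_nonneg fun x => sq_nonneg _
  have p2 : ∀ n, 0 ≤ ∫ x, ψ n x ^ 2 ∂(ν n) := fun n => integral_nonneg fun x => sq_nonneg _
  refine ⟨tendstoZeroL2_of_integral_sq hφ ?_, tendstoZeroL2_of_integral_sq hψ ?_⟩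
  · exact squeeze_zero' (Eventually.of_forall p1) (h.mono fun n hn => by linarith [p2 n]) hlim
  · exact squeeze_zero' (Eventually.of_forall p2) (h.mono fun n hn => by linarith [p1 n]) hlim

/-- Weak-* convergence to a positive constant gives a fixed volume in each ball. -/
lemma TendstoWeakStar.exists_le_volume_ball_inter {S : ℕ → Set (Space N)} {s : ℝ}
    (hstar : TendstoWeakStar Ω (fun n => (S n).indicator fun _ => 1) fun _ => s) (hs : 0 < s)
    (hΩ : IsOpen Ω) (hΩ_top : volume Ω ≠ ⊤)
    (hSm : ∀ᶠ n in atTop, MeasurableSet (S n)) {x : Space N} (hx : x ∈ Ω) {r : ℝ} (hr : 0 < r) :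
    ∃ η : ENNReal, η ≠ 0 ∧ ∀ᶠ n in atTop, η ≤ volume (Metric.ball x r ∩ S n) := by
  have hfΩ : IsFiniteMeasure (volume.restrict Ω) := isFiniteMeasure_restrict.2 hΩ_top
  set Q := Metric.ball x r
  have hQ : MeasurableSet Q := measurableSet_ball
  have hpos : 0 < volume.real (Q ∩ Ω) := by
    refine ENNReal.toReal_pos ?_ (measure_ne_top_of_subset Set.inter_subset_right hΩ_top)
    exact ((Metric.isOpen_ball.inter hΩ).measure_pos volume ⟨x, Metric.mem_ball_self hr, hx⟩).ne'
  -- Tested with the indicator of the ball, weak-* convergence gives the limit volume `s |Q ∩ Ω| >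
  -- 0`; half of it serves as the lower bound.
  have hlim := hstar (Q.indicator fun _ => 1) ((integrable_const (1 : ℝ)).indicator hQ)
  have hR : ∫ y in Ω, s * Q.indicator (fun _ => 1) y = s * volume.real (Q ∩ Ω) := by
    rw [integral_const_mul, integral_indicator_const _ hQ, measureReal_restrict_apply hQ,
      smul_eq_mul, mul_one]
  rw [hR] at hlim
  set c := s * volume.real (Q ∩ Ω)
  have hc : 0 < c := mul_pos hs hpos
  refine ⟨ENNReal.ofReal (c / 2), by simpa using hc, ?_⟩
  filter_upwards [hlim.eventually (lt_mem_nhds (half_lt_self hc)), hSm] with n hn hSn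
  have hL : ∫ y in Ω, (S n).indicator (fun _ => 1) y * Q.indicator (fun _ => 1) y
      = volume.real ((Q ∩ S n) ∩ Ω) := by
    have : ∀ y, (S n).indicator (fun _ => (1 : ℝ)) y * Q.indicator (fun _ => 1) y
        = (Q ∩ S n).indicator (fun _ => 1) y := fun y => by
      by_cases h1 : y ∈ S n <;> by_cases h2 : y ∈ Q <;> simp [h1, h2]
    simp only [this]
    rw [integral_indicator_const _ (hQ.inter hSn), measureReal_restrict_apply (hQ.inter hSn),
      smul_eq_mul, mul_one]
  rw [hL] at hn
  refine (ENNReal.ofReal_le_ofReal hn.le).trans ?_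
  rw [Measure.real, ENNReal.ofReal_toReal (measure_ne_top_of_subset Set.inter_subset_right hΩ_top)]
  exact measure_mono Set.inter_subset_left

lemma TendstoWeakStar.tendsto_setIntegral {S : ℕ → Set (Space N)} {s : ℝ}
    (hstar : TendstoWeakStar Ω (fun n => (S n).indicator fun _ => 1) fun _ => s)
    (hS : ∀ n, S n ⊆ Ω) (hSm : ∀ᶠ n in atTop, MeasurableSet (S n)) {g : Space N → ℝ}
    (hg : IntegrableOn g Ω) :
    Tendsto (fun n => ∫ x in S n, g x) atTop (𝓝 (s * ∫ x in Ω, g x)) := by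
  have hlim := hstar g hg
  rw [integral_const_mul] at hlim
  refine hlim.congr' ?_
  filter_upwards [hSm] with n hn
  have h : ∫ x in S n, g x = ∫ x in Ω ∩ S n, g x := by
    rw [Set.inter_eq_self_of_subset_right (hS n)]
  rw [h, ← setIntegral_indicator hn]
  refine integral_congr_ae (ae_of_all _ fun y => ?_)
  by_cases hy : y ∈ S n <;> simp [hy]

end Phases

/-! ### The homogenized system -/

section Homogenized

variable {N : ℕ} {J G : Space N → ℝ} {Ω : Set (Space N)} {X : ℝ} {f u v : Space N → ℝ}

/-- Division by the volume fraction rewrites the system for the profiles `u / X` and `v / (1 - X)`,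
in the form in which the residuals converge. -/
lemma IsHomogenizedSolution.eq_local (h : IsHomogenizedSolution J G Ω X f u v) (hX : X ≠ 0)
    (hX1 : 1 - X ≠ 0) :
    ∀ᵐ x ∂(volume.restrict Ω),
      f x = (1 - X) * ∫ y in Ω, J (x - y) * (v y / (1 - X) - u x / X) := by
  filter_upwards [h.eq_left] with x hx
  have : ∀ y, J (x - y) * (X * v y - (1 - X) * u x)
      = (X * (1 - X)) * (J (x - y) * (v y / (1 - X) - u x / X)) := fun y => by field_simp
  simp only [this, integral_const_mul] at hx
  refine mul_right_cancel₀ hX (hx.trans (by ring))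

lemma IsHomogenizedSolution.eq_nonlocal (h : IsHomogenizedSolution J G Ω X f u v) (hX : X ≠ 0)
    (hX1 : 1 - X ≠ 0) :
    ∀ᵐ x ∂(volume.restrict Ω),
      f x = (1 - X) * (∫ y in Ω, G (x - y) * (v y / (1 - X) - v x / (1 - X)))
        + X * ∫ y in Ω, J (x - y) * (u y / X - v x / (1 - X)) := by
  filter_upwards [h.eq_right] with x hx
  have h1 : ∀ y, G (x - y) * ((1 - X) * v y - (1 - X) * v x)
      = ((1 - X) * (1 - X)) * (G (x - y) * (v y / (1 - X) - v x / (1 - X))) := fun y => by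
    field_simp
  have h2 : ∀ y, J (x - y) * ((1 - X) * u y - X * v x)
      = ((1 - X) * X) * (J (x - y) * (u y / X - v x / (1 - X))) := fun y => by field_simp
  simp only [h1, h2, integral_const_mul] at hx
  refine mul_right_cancel₀ hX1 (hx.trans (by ring))

end Homogenized

/-! ### Mass of the correctors and conclusion -/

section Main

variable {N : ℕ} {Ω T : Set (Space N)} {ℓ : Fin N → ℝ} {X : ℝ}

lemma localRegion_union_nonlocalRegion (n : ℕ) :
    localRegion Ω ℓ T n ∪ nonlocalRegion Ω ℓ T n = Ω :=
  Set.union_sdiff_cancel localRegion_subset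

lemma disjoint_localRegion_nonlocalRegion (n : ℕ) :
    Disjoint (localRegion Ω ℓ T n) (nonlocalRegion Ω ℓ T n) :=
  Set.disjoint_sdiff_right

lemma nonlocalRegion_subset (n : ℕ) : nonlocalRegion Ω ℓ T n ⊆ Ω :=
  Set.sdiff_subset

lemma eventually_measurableSet_localRegion (hTo : IsOpen T) :
    ∀ᶠ n in atTop, MeasurableSet (localRegion Ω ℓ T n) :=
  (eventually_ge_atTop 1).mono fun _ hn => (isOpen_localRegion hn hTo).measurableSet

lemma eventually_measurableSet_nonlocalRegion (hΩ : IsOpen Ω) (hTo : IsOpen T) :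
    ∀ᶠ n in atTop, MeasurableSet (nonlocalRegion Ω ℓ T n) :=
  (eventually_measurableSet_localRegion hTo).mono fun _ hn => hΩ.measurableSet.diff hn

lemma corrector₂_of_mem {v : Space N → ℝ} {n : ℕ} {x : Space N}
    (hx : x ∈ nonlocalRegion Ω ℓ T n) : corrector₂ Ω ℓ T X v n x = v x / (1 - X) := by
  rw [corrector₂, Set.indicator_of_mem hx]

/-- The correctors have asymptotically vanishing total mass. -/
lemma tendsto_correctorMass (hΩ : IsOpen Ω) (hΩt : volume Ω ≠ ⊤) (hTo : IsOpen T) (hX : X ≠ 0)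
    (hX1 : 1 - X ≠ 0)
    (hA : TendstoWeakStar Ω (fun n => (localRegion Ω ℓ T n).indicator fun _ => 1) fun _ => X)
    (hB : TendstoWeakStar Ω (fun n => (nonlocalRegion Ω ℓ T n).indicator fun _ => 1)
      fun _ => 1 - X)
    {u v : Space N → ℝ} (hu : IntegrableOn u Ω) (hv : IntegrableOn v Ω)
    (h0 : (∫ x in Ω, u x) + (∫ x in Ω, v x) = 0)
    (hw : ∀ ε > 0, ∀ᶠ n in atTop, ∀ x ∈ localRegion Ω ℓ T n,
      |corrector₁ Ω ℓ T X u n x - u x / X| ≤ ε)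
    (hwi : ∀ᶠ n in atTop, IntegrableOn (corrector₁ Ω ℓ T X u n) (localRegion Ω ℓ T n)) :
    Tendsto (correctorMass Ω ℓ T X u v) atTop (𝓝 0) := by
  have hAm := eventually_measurableSet_localRegion (Ω := Ω) (ℓ := ℓ) hTo
  have hBm := eventually_measurableSet_nonlocalRegion (ℓ := ℓ) hΩ hTo
  have h1 := hA.tendsto_setIntegral (fun n => localRegion_subset) hAm (hu.div_const X)
  have h2 := hB.tendsto_setIntegral nonlocalRegion_subset hBm (hv.div_const (1 - X))
  have h3 : Tendsto (fun n => ∫ x in localRegion Ω ℓ T n,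
      (corrector₁ Ω ℓ T X u n x - u x / X)) atTop (𝓝 0) := by
    rw [Metric.tendsto_nhds]
    intro ε hε
    have hD : 0 < volume.real Ω + 1 := by positivity
    filter_upwards [hw (ε / (volume.real Ω + 1)) (by positivity), hAm] with n hn hnm
    rw [dist_zero_right]
    have hAt : volume (localRegion Ω ℓ T n) < ⊤ :=
      (measure_mono localRegion_subset).trans_lt hΩt.lt_top
    have hle : volume.real (localRegion Ω ℓ T n) ≤ volume.real Ω :=
      measureReal_mono localRegion_subset hΩt
    calc ‖∫ x in localRegion Ω ℓ T n, (corrector₁ Ω ℓ T X u n x - u x / X)‖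
        ≤ ε / (volume.real Ω + 1) * volume.real (localRegion Ω ℓ T n) :=
          norm_setIntegral_le_of_norm_le_const hAt hn
      _ < ε / (volume.real Ω + 1) * (volume.real Ω + 1) := by
          gcongr
          linarith
      _ = ε := by field_simp
  have hsum := (h3.add h1).add h2
  -- The weak-* limits `X` and `1 - X` cancel the denominators of the correctors, leaving `∫ u + ∫ v
  -- = 0`.
  have hlim : 0 + X * (∫ x in Ω, u x / X) + (1 - X) * ∫ x in Ω, v x / (1 - X) = 0 := by
    rw [integral_div, integral_div, mul_div_cancel₀ _ hX, mul_div_cancel₀ _ hX1, zero_add, h0]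
  rw [hlim] at hsum
  refine hsum.congr' ?_
  filter_upwards [hwi, hBm] with n hn hBn
  have huX : IntegrableOn (fun x => u x / X) (localRegion Ω ℓ T n) :=
    IntegrableOn.mono_set (hu.div_const X) localRegion_subset
  rw [correctorMass, integral_sub hn huX, sub_add_cancel]
  congr 1
  exact setIntegral_congr_fun hBn fun x hx => (corrector₂_of_mem hx).symm

lemma volume_ne_zero_of_holeFraction_pos (h : 0 < holeFraction ℓ T) : volume T ≠ 0 := by
  intro h0
  simp [holeFraction, Measure.real, h0] at h

end Main

end LocalHoles

open LocalHoles in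
theorem theorem2p2 {N : ℕ} (hN : 2 ≤ N)
    -- the bounded domain
    (Ω : Set (LocalHoles.Space N)) (hΩ_open : IsOpen Ω) (hΩ_conn : IsConnected Ω)
    (hΩ_bdd : Bornology.IsBounded Ω)
    -- the kernels
    (J G : LocalHoles.Space N → ℝ) (hJ : LocalHoles.IsKernel J) (hG : LocalHoles.IsKernel G)
    (hJ_supp : ∃ R : ℝ, Metric.diam Ω < R ∧ Metric.ball 0 R ⊆ tsupport J)
    -- the periodicity cell, the reference hole and the volume fraction
    (ℓ : Fin N → ℝ) (hℓ : ∀ i, 0 < ℓ i)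
    (T : Set (LocalHoles.Space N)) (hT_open : IsOpen T) (hT_cell : closure T ⊆ LocalHoles.cell ℓ)
    (X : ℝ) (hX : X = LocalHoles.holeFraction ℓ T) (hX_pos : 0 < X) (hX_lt : X < 1)
    -- the sources
    (f : ℕ → LocalHoles.Space N → ℝ) (f' : LocalHoles.Space N → ℝ)
    (hf : ∀ n, 1 ≤ n → MemLp (f n) 2 (volume.restrict Ω))
    (hf_mean : ∀ n, 1 ≤ n → ∫ x in Ω, f n x = 0)
    (hf' : MemLp f' 2 (volume.restrict Ω))
    (hf_lim : Tendsto (fun n => eLpNorm (fun x => f n x - f' x) 2 (volume.restrict Ω))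
      atTop (𝓝 0))
    -- the weak solutions of the coupled problems
    (u v : ℕ → LocalHoles.Space N → ℝ)
    (huv : ∀ n, 1 ≤ n → LocalHoles.IsWeakSolution J G (LocalHoles.localRegion Ω ℓ T n)
      (LocalHoles.nonlocalRegion Ω ℓ T n) (f n) (u n) (v n))
    -- the solution of the homogenized system
    (u' v' : LocalHoles.Space N → ℝ)
    (huv' : LocalHoles.IsHomogenizedSolution J G Ω X f' u' v')
    (hu' : ContinuousOn u' (closure Ω)) :
    -- `X` and `1 - X` are the weak-* limits of the characteristic functions
    (LocalHoles.TendstoWeakStar Ω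
        (fun n => (LocalHoles.localRegion Ω ℓ T n).indicator (fun _ => 1)) (fun _ => X) ∧
      LocalHoles.TendstoWeakStar Ω
        (fun n => (LocalHoles.nonlocalRegion Ω ℓ T n).indicator (fun _ => 1)) (fun _ => 1 - X)) ∧
    -- convergence with correctors
    Tendsto
      (fun n =>
        eLpNorm (fun x => u n x - (LocalHoles.corrector₁ Ω ℓ T X u' n x
            - 1 / 2 * (LocalHoles.correctorMass Ω ℓ T X u' v' n
              / volume.real (LocalHoles.localRegion Ω ℓ T n))))
          2 (volume.restrict (LocalHoles.localRegion Ω ℓ T n))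
        + eLpNorm (fun x => v n x - (LocalHoles.corrector₂ Ω ℓ T X v' n x
            - 1 / 2 * (LocalHoles.correctorMass Ω ℓ T X u' v' n
              / volume.real (LocalHoles.nonlocalRegion Ω ℓ T n))))
          2 (volume.restrict (LocalHoles.nonlocalRegion Ω ℓ T n)))
      atTop (𝓝 0) := by
  have hΩt : volume Ω ≠ ⊤ := hΩ_bdd.measure_lt_top.ne
  have hΩ0 : volume Ω ≠ 0 := (hΩ_open.measure_pos volume hΩ_conn.nonempty).ne'
  have hV : 0 < volume.real Ω := ENNReal.toReal_pos hΩ0 hΩt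
  have hT' : T ⊆ cell ℓ := subset_closure.trans hT_cell
  have hT0 : volume T ≠ 0 := volume_ne_zero_of_holeFraction_pos (hX ▸ hX_pos)
  have hX1 : 0 < 1 - X := sub_pos.2 hX_lt
  have hAstar : TendstoWeakStar Ω (fun n => (localRegion Ω ℓ T n).indicator fun _ => 1)
      fun _ => X := hX ▸ tendstoWeakStar_localRegion hℓ hT_open hT_cell hΩ_open
  have hBstar : TendstoWeakStar Ω (fun n => (nonlocalRegion Ω ℓ T n).indicator fun _ => 1)
      fun _ => 1 - X := hX ▸ tendstoWeakStar_nonlocalRegion hℓ hT_open hT_cell hΩ_open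
  refine ⟨⟨hAstar, hBstar⟩, ?_⟩
  set A := localRegion Ω ℓ T
  set B := nonlocalRegion Ω ℓ T
  set w := corrector₁ Ω ℓ T X u'
  set m := correctorMass Ω ℓ T X u' v'
  have hAB : ∀ n, A n ∪ B n = Ω := localRegion_union_nonlocalRegion
  have hdisj : ∀ n, Disjoint (A n) (B n) := disjoint_localRegion_nonlocalRegion
  have hA : ∀ n, A n ⊆ Ω := fun n => localRegion_subset
  have hB : ∀ n, B n ⊆ Ω := nonlocalRegion_subset
  have hAm : ∀ᶠ n in atTop, MeasurableSet (A n) := eventually_measurableSet_localRegion hT_open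
  have hBm : ∀ᶠ n in atTop, MeasurableSet (B n) :=
    eventually_measurableSet_nonlocalRegion hΩ_open hT_open
  have hfΩ : IsFiniteMeasure (volume.restrict Ω) := isFiniteMeasure_restrict.2 hΩt
  have hfA : ∀ n, IsFiniteMeasure (volume.restrict (A n)) := fun n =>
    isFiniteMeasure_restrict.2 (measure_ne_top_of_subset (hA n) hΩt)
  have hfB : ∀ n, IsFiniteMeasure (volume.restrict (B n)) := fun n =>
    isFiniteMeasure_restrict.2 (measure_ne_top_of_subset (hB n) hΩt)
  have hleA : ∀ n, volume.restrict (A n) ≤ volume.restrict Ω := fun n =>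
    Measure.restrict_mono_set _ (hA n)
  have hleB : ∀ n, volume.restrict (B n) ≤ volume.restrict Ω := fun n =>
    Measure.restrict_mono_set _ (hB n)
  obtain ⟨C, hC, hcoer⟩ := hJ.exists_integral_sq_le hΩ_bdd hΩ0 hA hB
    (exists_crossVariation_le hΩ_conn.isPreconnected hΩ_bdd hJ.continuous hJ.pos_zero hAm hBm hAB
      (fun x hx r hr => hAstar.exists_le_volume_ball_inter hX_pos hΩ_open hΩt hAm hx hr)
      fun x hx r hr => hBstar.exists_le_volume_ball_inter hX1 hΩ_open hΩt hBm hx hr)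
  have hU : MemLp (fun x => u' x / X) 2 (volume.restrict Ω) := by
    simpa only [div_eq_mul_inv] using huv'.memLp_left.mul_const X⁻¹
  have hVL : MemLp (fun x => v' x / (1 - X)) 2 (volume.restrict Ω) := by
    simpa only [div_eq_mul_inv] using huv'.memLp_right.mul_const (1 - X)⁻¹
  have hw : ∀ ε > 0, ∀ᶠ n in atTop, ∀ x ∈ A n, |w n x - u' x / X| ≤ ε := fun ε hε =>
    eventually_abs_corrector₁_sub_le hℓ hT_open hT' hT0 hΩ_bdd (hU.integrable one_le_two) hu' hε
  have hwm : ∀ᶠ n in atTop, AEStronglyMeasurable (w n) (volume.restrict (A n)) :=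
    (eventually_ge_atTop 1).mono fun n hn => aestronglyMeasurable_corrector₁ hℓ hn hT_open hT'
  have hwdiff : TendstoZeroL2 (fun n => volume.restrict (A n)) fun n x => w n x - u' x / X := by
    refine tendstoZeroL2_of_uniform hleA ?_ fun ε hε => ?_
    · exact hwm.mono fun n hn => hn.sub (hU.1.mono_measure (hleA n))
    · filter_upwards [hw ε hε, hAm] with n hn hnm
      filter_upwards [ae_restrict_mem hnm] with x hx using hn x hx
  have hwL : ∀ᶠ n in atTop, MemLp (w n) 2 (volume.restrict (A n)) := by
    filter_upwards [hwdiff.memLp] with n hn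
    refine (hn.add (hU.mono_measure (hleA n))).ae_eq (ae_of_all _ fun x => ?_)
    simp
  have hmass : Tendsto m atTop (𝓝 0) :=
    tendsto_correctorMass hΩ_open hΩt hT_open hX_pos.ne' hX1.ne' hAstar hBstar
      (huv'.memLp_left.integrable one_le_two) (huv'.memLp_right.integrable one_le_two)
      huv'.mean_zero hw (hwL.mono fun n hn => hn.integrable one_le_two)
  have hfz : TendstoZeroL2 (fun _ => volume.restrict Ω) fun n x => f n x - f' x :=
    ⟨(eventually_ge_atTop 1).mono fun n hn => (hf n hn).sub hf', hf_lim⟩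
  have hr₁ := tendstoZeroL2_residual₁ hJ hΩt hAm hBm hA hB hBstar hfz hU hVL hw hwm
    (huv'.eq_local hX_pos.ne' hX1.ne')
  have hr₂ := tendstoZeroL2_residual₂ hJ hG hΩt hAm hBm hA hB hAstar hBstar hfz hU hVL hw hwL
    (huv'.eq_nonlocal hX_pos.ne' hX1.ne')
  -- The same constant is subtracted in both phases. This restores total mean zero, because `|A n| +
  -- |B n| = |Ω|`, and leaves the residuals unchanged, because they only see differences.
  set φ : ℕ → Space N → ℝ := fun n x => u n x - (w n x - m n / volume.real Ω)
  set ψ : ℕ → Space N → ℝ := fun n x => v n x - (v' x / (1 - X) - m n / volume.real Ω)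
  have hφ : ∀ᶠ n in atTop, MemLp (φ n) 2 (volume.restrict (A n)) := by
    filter_upwards [hwL, eventually_ge_atTop 1] with n h1 hn
    obtain ⟨gu, hadm, -⟩ := huv n hn
    exact hadm.isH1.memLp.sub (h1.sub (memLp_const _))
  have hψ : ∀ᶠ n in atTop, MemLp (ψ n) 2 (volume.restrict (B n)) := by
    filter_upwards [eventually_ge_atTop 1] with n hn
    obtain ⟨gu, hadm, -⟩ := huv n hn
    exact hadm.memLp.sub ((hVL.mono_measure (hleB n)).sub (memLp_const _))
  obtain ⟨hφ0, hψ0⟩ := hr₁.of_integral_sq_add_le (C := C ^ 2) hr₂ hφ hψ <| by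
    filter_upwards [hcoer, hφ, hψ, hr₁.memLp, hr₂.memLp, hAm, hBm, hwL, eventually_ge_atTop 1]
      with n hcn hφn hψn hr1n hr2n hAn hBn hwn hn
    have hVB := hVL.mono_measure (hleB n)
    have hmean : (∫ x in A n, φ n x) + (∫ x in B n, ψ n x) = 0 := by
      obtain ⟨gu, hadm, -⟩ := huv n hn
      have hmB : m n = (∫ x in A n, w n x) + ∫ x in B n, v' x / (1 - X) := by
        simp only [m, correctorMass]
        congr 1
        exact setIntegral_congr_fun hBn fun x hx => corrector₂_of_mem hx
      have hvol : volume.real (A n) + volume.real (B n) = volume.real Ω := by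
        rw [← hAB n, measureReal_union (hdisj n) hBn
          (measure_ne_top_of_subset (hA n) hΩt) (measure_ne_top_of_subset (hB n) hΩt)]
      have i1 : ∫ x in A n, φ n x = (∫ x in A n, u n x) - ((∫ x in A n, w n x)
          - volume.real (A n) * (m n / volume.real Ω)) := by
        have hw1 := hwn.integrable one_le_two
        have hw2 : Integrable (fun x => w n x - m n / volume.real Ω) (volume.restrict (A n)) :=
          hw1.sub (integrable_const _)
        rw [integral_sub (hadm.isH1.memLp.integrable one_le_two) hw2,
          integral_sub hw1 (integrable_const _)]
        simp
      have i2 : ∫ x in B n, ψ n x = (∫ x in B n, v n x) - ((∫ x in B n, v' x / (1 - X))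
          - volume.real (B n) * (m n / volume.real Ω)) := by
        have hv1 := hVB.integrable one_le_two
        have hv2 : Integrable (fun x => v' x / (1 - X) - m n / volume.real Ω)
            (volume.restrict (B n)) := hv1.sub (integrable_const _)
        rw [integral_sub (hadm.memLp.integrable one_le_two) hv2,
          integral_sub hv1 (integrable_const _)]
        simp
      have hfrac : (volume.real (A n) + volume.real (B n)) * (m n / volume.real Ω) = m n := by
        rw [hvol]
        field_simp
      rw [i1, i2]
      linarith [hadm.mean_zero]
    refine integral_sq_add_le_of_coercive hAn hBn (hAB n) (hdisj n) hΩt hC hcn hφn hψn hr1n hr2n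
      hmean ?_
    have hH1 : IsH1 (A n) (fun x => w n x - m n / volume.real Ω) 0 :=
      isH1_of_locallyConstant (hwn.sub (memLp_const _)) fun x hx =>
        (corrector₁_eventuallyEq (X := X) (u := u') hℓ hn hT_open hT' hx).mono fun y hy => by
          simp only [w, hy]
    have hVc : MemLp (fun x => v' x / (1 - X) - m n / volume.real Ω) 2 (volume.restrict (B n)) :=
      hVB.sub (memLp_const _)
    have hen := couplingEnergy_le_residual hJ hG ((hf n hn).mono_measure (hleA n))
      ((hf n hn).mono_measure (hleB n)) (huv n hn) hH1 hVc hmean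
    simpa only [residual₁, residual₂, sub_sub_sub_cancel_right] using hen
  -- The normalization is changed from `m n / |Ω|` to the one in the theorem. Both constants tend to
  -- zero, since `m n → 0` while `|S n| → s |Ω| ≠ 0`.
  have hconst : ∀ (S : ℕ → Set (Space N)) (s : ℝ), s ≠ 0 → (∀ n, S n ⊆ Ω) →
      (∀ᶠ n in atTop, MeasurableSet (S n)) →
      TendstoWeakStar Ω (fun n => (S n).indicator fun _ => 1) (fun _ => s) →
      TendstoZeroL2 (fun n => volume.restrict (S n)) fun n _ =>
        1 / 2 * (m n / volume.real (S n)) - m n / volume.real Ω := by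
    intro S s hs hS hSm hstar
    have hvol := hstar.tendsto_setIntegral hS hSm (integrable_const (1 : ℝ))
    simp only [integral_const, measureReal_restrict_apply_univ, smul_eq_mul, mul_one] at hvol
    have hlim := ((hmass.div hvol (mul_ne_zero hs hV.ne')).const_mul (1 / 2)).sub
      (hmass.div_const (volume.real Ω))
    simp only [zero_div, mul_zero, sub_zero] at hlim
    refine tendstoZeroL2_of_uniform (m := volume.restrict Ω)
      (fun n => Measure.restrict_mono_set _ (hS n))
      (Eventually.of_forall fun n => aestronglyMeasurable_const) fun ε hε => ?_
    filter_upwards [(Metric.tendsto_nhds.1 hlim) ε hε] with n hn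
    rw [Real.dist_0_eq_abs] at hn
    exact ae_of_all _ fun x => hn.le
  have hleft := (hφ0.add (hconst A X hX_pos.ne' hA hAm hAstar)).tendsto
  have hright := (hψ0.add (hconst B (1 - X) hX1.ne' hB hBm hBstar)).tendsto
  have hsum := hleft.add hright
  rw [add_zero] at hsum
  refine hsum.congr' ?_
  filter_upwards [hBm] with n hBn
  congr 1
  · congr 1
    ext x
    simp only [φ]
    ring
  · refine eLpNorm_congr_ae ?_
    filter_upwards [ae_restrict_mem hBn] with x hx
    rw [corrector₂_of_mem hx]
    simp only [ψ]
    ring
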